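/- Let $G$ be a rational function of degree $d\ge 2$ on $\mathbb P^1=\mathbb P^1(\mathbb C)$, and let $V_o$ be an irreducible component, for the Zariski topology, of $$V_G=\{(x,y)\in\mathbb P^1\times\mathbb P^1 : G(x)=G(y)\}.$$ Denote by $G^{-1}\circ G$ the multi-valued function on $\mathbb P^1$ with graph $V_o$; its branches are the holomorphic germs $b$ whose graphs are locally contained in $V_o$ (so that $G\circ b=G$). For rational functions $\widetilde G,\widetilde F$, the equation $(G^{-1}\circ G)\circ\widetilde G=\widetilde F$ means that $b\circ\widetilde G=\widetilde F$ near some point, for some branch $b$ of $G^{-1}\circ G$. The following are equivalent: 1. The normalization $\widetilde V_o$ of $V_o$ has genus zero. 2. There are nonconstant rational functions $\widetilde G$ and $\widetilde F$ with $(G^{-1}\circ G)\circ\widetilde G=\widetilde F$. 3. $V_o$ is rationally parametrized: there are rational functions $\widetilde G$ and $\widetilde F$ such that $z\mapsto(\widetilde G(z),\widetilde F(z))$ maps $\mathbb P^1$ onto $V_o$ and is injective outside a finite set. Here the genus of a smooth projective curve $X$ over $\mathbb C$ is the maximum of $\deg D-\dim_{\mathbb C} L(D)+1$ over all divisors $D$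 on $X$, where $L(D)$ is the Riemann-Roch space of $D$. -/

import Mathlib

open scoped Topology WithZero

noncomputable section

namespace RatCorr

/-! ### Rational functions as self-maps of the Riemann sphere `ℙ¹ = ℂ ∪ {∞}` -/

/-- The complex projective line. -/
abbrev P1 : Type := OnePoint ℂ

/-- The degree of a rational function, the maximum of the degrees of numerator and denominator in
lowest terms. The rational functions of degree `0` are the constants. -/
def degree (f : RatFunc ℂ) : ℕ := max f.num.natDegree f.denom.natDegree

/-- The map `ℙ¹ → ℙ¹` given by a rational function (`num` and `denom` are coprime). -/
def toMap (f : RatFunc ℂ) : P1 → P1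
  | none => if f.denom.natDegree < f.num.natDegree then OnePoint.infty
      else ((f.num.coeff f.denom.natDegree / f.denom.coeff f.denom.natDegree : ℂ) : P1)
  | some z => if f.denom.eval z = 0 then OnePoint.infty
      else ((f.num.eval z / f.denom.eval z : ℂ) : P1)

/-- The correspondence `V_G = {(x, y) ∈ ℙ¹ × ℙ¹ | G x = G y}`. -/
def graph (G : RatFunc ℂ) : Set (P1 × P1) := {p | toMap G p.1 = toMap G p.2}

/-! ### The Zariski topology of `ℙ¹ × ℙ¹` -/

/-- Homogeneous coordinates on `ℙ¹`: `z = [z : 1]` and `∞ = [1 : 0]`. -/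
def coord : P1 → Fin 2 → ℂ
  | none => ![1, 0]
  | some z => ![z, 1]

/-- The bidegrees of the variables `x₀, x₁` (left) and `y₀, y₁` (right). -/
def bidegree : Fin 2 ⊕ Fin 2 → ℕ × ℕ := Sum.elim (fun _ => (1, 0)) (fun _ => (0, 1))

/-- The value of a polynomial in `x₀, x₁, y₀, y₁` at the chosen homogeneous coordinates of a
point. For a bihomogeneous polynomial, whether it vanishes does not depend on the choice. -/
def formEval (F : MvPolynomial (Fin 2 ⊕ Fin 2) ℂ) (p : P1 × P1) : ℂ :=
  MvPolynomial.eval (Sum.elim (coord p.1) (coord p.2)) F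

/-- The Zariski topology on `ℙ¹ × ℙ¹`, whose basic open sets are the non-vanishing loci of
bihomogeneous polynomials. -/
@[reducible] def zariski : TopologicalSpace (P1 × P1) :=
  TopologicalSpace.generateFrom {U | ∃ F m, MvPolynomial.IsWeightedHomogeneous bidegree F m ∧
    U = {p | formEval F p ≠ 0}}

/-- An irreducible component of `V_G`, for a rational function `G` of degree at least two:
a maximal Zariski-irreducible subset of `V_G`. -/
structure GraphComponent (G : RatFunc ℂ) (hG : 2 ≤ degree G) where
  carrier : Set (P1 × P1)
  maximal : Maximal (fun S => S ⊆ graph G ∧ @IsIrreducible _ zariski S) carrier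

/-- The affine part `V ∩ ℂ²` of a subset of `ℙ¹ × ℙ¹`. -/
def affinePart (V : Set (P1 × P1)) : Set (Fin 2 → ℂ) :=
  {w | ((w 0 : P1), (w 1 : P1)) ∈ V}

/-! ### The affine part of a component is a nonempty irreducible affine curve -/

lemma formEval_mul (F H : MvPolynomial (Fin 2 ⊕ Fin 2) ℂ) (p : P1 × P1) :
    formEval (F * H) p = formEval F p * formEval H p := by
  simp [formEval]

lemma isOpen_form {F : MvPolynomial (Fin 2 ⊕ Fin 2) ℂ} {m : ℕ × ℕ}
    (hF : F.IsWeightedHomogeneous bidegree m) : IsOpen[zariski] {p | formEval F p ≠ 0} :=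
  TopologicalSpace.isOpen_generateFrom_of_mem ⟨F, m, hF, rfl⟩

lemma isClosed_form {F : MvPolynomial (Fin 2 ⊕ Fin 2) ℂ} {m : ℕ × ℕ}
    (hF : F.IsWeightedHomogeneous bidegree m) : IsClosed[zariski] {p | formEval F p = 0} := by
  rw [← @isOpen_compl_iff _ _ zariski]
  exact isOpen_form hF

lemma exists_form_of_isOpen {U : Set (P1 × P1)} (hU : IsOpen[zariski] U) (p : P1 × P1)
    (hp : p ∈ U) : ∃ F m, MvPolynomial.IsWeightedHomogeneous bidegree F m ∧ formEval F p ≠ 0 ∧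
      ∀ q, formEval F q ≠ 0 → q ∈ U := by
  induction hU with
  | basic s hs =>
    obtain ⟨F, m, hF, rfl⟩ := hs
    exact ⟨F, m, hF, hp, fun q hq => hq⟩
  | univ => exact ⟨1, 0, MvPolynomial.isWeightedHomogeneous_one _ _, by simp [formEval], by simp⟩
  | inter s t _ _ hs ht =>
    obtain ⟨F, m, hF, hFp, hF'⟩ := hs hp.1
    obtain ⟨H, n, hH, hHp, hH'⟩ := ht hp.2
    refine ⟨F * H, m + n, hF.mul hH, ?_, fun q hq => ?_⟩
    · rw [formEval_mul]; exact mul_ne_zero hFp hHp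
    · rw [formEval_mul] at hq
      exact ⟨hF' q (left_ne_zero_of_mul hq), hH' q (right_ne_zero_of_mul hq)⟩
  | sUnion S _ ih =>
    obtain ⟨s, hs, hps⟩ := hp
    obtain ⟨F, m, hF, hFp, hF'⟩ := ih s hs hps
    exact ⟨F, m, hF, hFp, fun q hq => ⟨s, hs, hF' q hq⟩⟩

lemma formEval_scale {F : MvPolynomial (Fin 2 ⊕ Fin 2) ℂ} {m : ℕ × ℕ}
    (hF : F.IsWeightedHomogeneous bidegree m) (s t : ℂ) (c d : Fin 2 → ℂ) :
    MvPolynomial.eval (Sum.elim (s • c) (t • d)) F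
      = s ^ m.1 * t ^ m.2 * MvPolynomial.eval (Sum.elim c d) F := by
  induction hF using MvPolynomial.IsWeightedHomogeneous.induction_on with
  | zero => simp
  | add p q _ _ hp hq => rw [map_add, hp, hq, map_add]; ring
  | monomial e r he =>
    subst he
    rw [Finsupp.weight_apply, Finsupp.sum_fintype _ _ (by simp)]
    simp [MvPolynomial.eval_monomial, Finsupp.prod_fintype, Fintype.prod_sum_type,
      Fin.prod_univ_two, bidegree, mul_pow, pow_add]
    ring

lemma exists_homogenization (f : MvPolynomial (Fin 2) ℂ) :
    ∃ F m, MvPolynomial.IsWeightedHomogeneous bidegree F m ∧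
      ∀ w : Fin 2 → ℂ, formEval F ((w 0 : P1), (w 1 : P1)) = MvPolynomial.eval w f := by
  suffices h : ∃ N : ℕ, ∀ n, N ≤ n → ∃ F, MvPolynomial.IsWeightedHomogeneous bidegree F (n, n) ∧
      ∀ w : Fin 2 → ℂ, formEval F ((w 0 : P1), (w 1 : P1)) = MvPolynomial.eval w f by
    obtain ⟨N, hN⟩ := h
    obtain ⟨F, hF⟩ := hN N le_rfl
    exact ⟨F, _, hF⟩
  have key : ∀ n : ℕ, MvPolynomial.IsWeightedHomogeneous (R := ℂ) bidegree
      (MvPolynomial.X (Sum.inl 1) ^ n * MvPolynomial.X (Sum.inr 1) ^ n) (n, n) := by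
    intro n
    have h := ((MvPolynomial.isWeightedHomogeneous_X ℂ bidegree (Sum.inl 1)).pow n).mul
      ((MvPolynomial.isWeightedHomogeneous_X ℂ bidegree (Sum.inr 1)).pow n)
    simpa [bidegree] using h
  induction f using MvPolynomial.induction_on with
  | C a =>
    refine ⟨0, fun n _ => ⟨_, (key n).C_mul a, fun w => ?_⟩⟩
    simp [formEval, coord]
  | add p q hp hq =>
    obtain ⟨N, hN⟩ := hp
    obtain ⟨M, hM⟩ := hq
    refine ⟨max N M, fun n hn => ?_⟩
    obtain ⟨F, hF, hF'⟩ := hN n (le_trans (le_max_left _ _) hn)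
    obtain ⟨H, hH, hH'⟩ := hM n (le_trans (le_max_right _ _) hn)
    refine ⟨F + H, hF.add hH, fun w => ?_⟩
    rw [map_add, ← hF', ← hH']
    simp [formEval]
  | mul_X p i hp =>
    obtain ⟨N, hN⟩ := hp
    refine ⟨N + 1, fun n hn => ?_⟩
    obtain ⟨n, rfl⟩ : ∃ k, n = k + 1 := ⟨n - 1, by omega⟩
    obtain ⟨F, hF, hF'⟩ := hN n (by omega)
    have hX := fun j => MvPolynomial.isWeightedHomogeneous_X ℂ bidegree j
    fin_cases i
    · refine ⟨F * (MvPolynomial.X (Sum.inl 0) * MvPolynomial.X (Sum.inr 1)), ?_, fun w => ?_⟩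
      · simpa [bidegree] using hF.mul ((hX (Sum.inl 0)).mul (hX (Sum.inr 1)))
      · rw [formEval_mul, hF']
        simp [formEval, coord]
    · refine ⟨F * (MvPolynomial.X (Sum.inl 1) * MvPolynomial.X (Sum.inr 0)), ?_, fun w => ?_⟩
      · simpa [bidegree] using hF.mul ((hX (Sum.inl 1)).mul (hX (Sum.inr 0)))
      · rw [formEval_mul, hF']
        simp [formEval, coord]

/-- An affine chart of `ℙ¹` centred at `a`. -/
def chart : P1 → ℂ → P1
  | none => fun u => if u = 0 then OnePoint.infty else ((u⁻¹ : ℂ) : P1)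
  | some a => fun u => ((a + u : ℂ) : P1)

/-- Homogeneous coordinates of the points in the chart centred at `a`, polynomial in `u`. -/
def chartVec : P1 → Polynomial ℂ × Polynomial ℂ
  | none => (1, Polynomial.X)
  | some a => (Polynomial.C a + Polynomial.X, 1)

lemma chart_zero (a : P1) : chart a 0 = a := by
  rcases a with _ | a
  · simp [chart]; rfl
  · simp [chart]; rfl

lemma eq_zero_of_chart_eq {a : P1} {u : ℂ} (h : chart a u = a) : u = 0 := by
  rcases a with _ | a
  · by_contra hu
    simp only [chart, hu, if_false] at h
    exact OnePoint.coe_ne_infty _ h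
  · have h' : a + u = a := OnePoint.coe_injective h
    simpa using h'

lemma chartVec_eval (a : P1) (u : ℂ) : ∃ c : ℂ, c ≠ 0 ∧
    ![(chartVec a).1.eval u, (chartVec a).2.eval u] = c • coord (chart a u) := by
  rcases a with _ | a
  · by_cases hu : u = 0
    · refine ⟨1, one_ne_zero, ?_⟩
      have : chart none u = none := by simp [chart, hu]; rfl
      rw [this]
      simp [chartVec, coord, hu]
    · refine ⟨u, hu, ?_⟩
      have : chart none u = some (u⁻¹) := by simp [chart, hu]; rfl
      rw [this]
      simp [chartVec, coord, hu]
  · refine ⟨1, one_ne_zero, ?_⟩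
    have : chart (some a) u = some (a + u) := rfl
    rw [this]
    simp [chartVec, coord]

lemma eval_reflect (f : Polynomial ℂ) (N : ℕ) (hf : f.natDegree ≤ N) (u : ℂ) (hu : u ≠ 0) :
    (f.reflect N).eval u = u ^ N * f.eval u⁻¹ := by
  let _ : Invertible u⁻¹ := invertibleOfNonzero (inv_ne_zero hu)
  have h := Polynomial.eval₂_reflect_mul_pow (RingHom.id ℂ) u⁻¹ N f hf
  simp only [invOf_eq_inv, inv_inv, Polynomial.eval₂_id] at h
  rw [← h, mul_comm, mul_assoc, ← mul_pow, inv_mul_cancel₀ hu, one_pow, mul_one]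

lemma not_both_zero (G : RatFunc ℂ) (z : ℂ) (h : G.denom.eval z = 0) : G.num.eval z ≠ 0 := by
  intro h'
  obtain ⟨a, b, hab⟩ := G.isCoprime_num_denom
  have := congrArg (Polynomial.eval z) hab
  simp [h, h'] at this

lemma exists_chart_fraction (G : RatFunc ℂ) (a : P1) : ∃ N D : Polynomial ℂ, ∀ u,
    (D.eval u ≠ 0 ∧ toMap G (chart a u) = ((N.eval u / D.eval u : ℂ) : P1)) ∨
    (D.eval u = 0 ∧ N.eval u ≠ 0 ∧ toMap G (chart a u) = OnePoint.infty) := by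
  have key : ∀ z : ℂ,
      (G.denom.eval z ≠ 0 ∧ toMap G (z : P1) = ((G.num.eval z / G.denom.eval z : ℂ) : P1)) ∨
      (G.denom.eval z = 0 ∧ G.num.eval z ≠ 0 ∧ toMap G (z : P1) = OnePoint.infty) := by
    intro z
    by_cases h : G.denom.eval z = 0
    · exact Or.inr ⟨h, not_both_zero G z h, if_pos h⟩
    · exact Or.inl ⟨h, if_neg h⟩
  rcases a with _ | a
  · refine ⟨G.num.reflect (degree G), G.denom.reflect (degree G), fun u => ?_⟩
    by_cases hu : u = 0
    · have hc : chart none u = none := by simp [chart, hu]; rfl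
      have he : ∀ f : Polynomial ℂ, (f.reflect (degree G)).eval u = f.coeff (degree G) := by
        intro f
        rw [hu, ← Polynomial.coeff_zero_eq_eval_zero, Polynomial.coeff_reflect]
        simp
      rw [he, he, hc]
      by_cases hd : G.denom.natDegree < G.num.natDegree
      · right
        have hdeg : degree G = G.num.natDegree := max_eq_left hd.le
        rw [hdeg]
        refine ⟨Polynomial.coeff_eq_zero_of_natDegree_lt hd, ?_, if_pos hd⟩
        intro h0
        have : G.num = 0 := Polynomial.leadingCoeff_eq_zero.mp h0
        simp [this] at hd
      · left
        have hdeg : degree G = G.denom.natDegree := max_eq_right (not_lt.mp hd)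
        rw [hdeg]
        refine ⟨?_, if_neg hd⟩
        intro h0
        exact G.denom_ne_zero (Polynomial.leadingCoeff_eq_zero.mp h0)
    · have hc : chart none u = ((u⁻¹ : ℂ) : P1) := by simp [chart, hu]
      have hn := eval_reflect G.num (degree G) (le_max_left _ _) u hu
      have hd := eval_reflect G.denom (degree G) (le_max_right _ _) u hu
      rw [hn, hd, hc]
      have hp : u ^ degree G ≠ 0 := pow_ne_zero _ hu
      rcases key u⁻¹ with ⟨h1, h2⟩ | ⟨h1, h2, h3⟩
      · exact Or.inl ⟨mul_ne_zero hp h1, by rw [h2, mul_div_mul_left _ _ hp]⟩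
      · exact Or.inr ⟨by rw [h1, mul_zero], mul_ne_zero hp h2, h3⟩
  · refine ⟨G.num.comp (Polynomial.C a + Polynomial.X),
      G.denom.comp (Polynomial.C a + Polynomial.X), fun u => ?_⟩
    simp only [Polynomial.eval_comp, Polynomial.eval_add, Polynomial.eval_C, Polynomial.eval_X]
    exact key (a + u)

lemma finite_fiber {G : RatFunc ℂ} (hG : 2 ≤ degree G) (c : P1) :
    {y | toMap G y = c}.Finite := by
  have hdiv : ∀ p : Polynomial ℂ, p ≠ 0 → (∀ z : ℂ, toMap G (z : P1) = c → p.eval z = 0) →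
      {y | toMap G y = c}.Finite := by
    intro p hp h
    refine Set.Finite.subset (((p.roots.toFinset.finite_toSet).image
      (fun z : ℂ => (z : P1))).insert OnePoint.infty) ?_
    intro y hy
    rcases y with _ | z
    · exact Or.inl rfl
    · refine Or.inr ⟨z, ?_, rfl⟩
      simp only [Multiset.mem_toFinset, Finset.mem_coe, Polynomial.mem_roots hp]
      exact h z hy
  have hmap : ∀ z : ℂ, toMap G (z : P1) = if G.denom.eval z = 0 then OnePoint.infty
      else ((G.num.eval z / G.denom.eval z : ℂ) : P1) := fun z => rfl
  rcases c with _ | c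
  · refine hdiv G.denom G.denom_ne_zero fun z hz => ?_
    by_contra h
    rw [hmap, if_neg h] at hz
    exact OnePoint.coe_ne_infty _ hz
  · refine hdiv (G.num - Polynomial.C c * G.denom) ?_ fun z hz => ?_
    · intro h0
      have h1 : G.num = Polynomial.C c * G.denom := sub_eq_zero.mp h0
      obtain ⟨a, b, hab⟩ := G.isCoprime_num_denom
      have hu : IsUnit G.denom := by
        refine isUnit_of_dvd_one ⟨a * Polynomial.C c + b, ?_⟩
        rw [← hab, h1]; ring
      have hd0 : G.denom.natDegree = 0 := Polynomial.natDegree_eq_zero_of_isUnit hu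
      have hn0 : G.num.natDegree = 0 := by
        have := Polynomial.natDegree_C_mul_le c G.denom
        rw [← h1] at this; omega
      simp [degree, hd0, hn0] at hG
    · rw [hmap] at hz
      split_ifs at hz with h
      · exact absurd hz (OnePoint.infty_ne_coe _)
      · have : G.num.eval z / G.denom.eval z = c := OnePoint.coe_injective hz
        rw [div_eq_iff h] at this
        simp [this]

lemma isClosed_coord (i : Fin 2) (a : P1) :
    IsClosed[zariski] {p : P1 × P1 | (if i = 0 then p.1 else p.2) = a} := by
  have hX := fun j => MvPolynomial.isWeightedHomogeneous_X ℂ bidegree j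
  have hlin : ∀ b : P1, coord b 0 * coord a 1 - coord b 1 * coord a 0 = 0 ↔ b = a := by
    intro b
    rcases a with _ | a <;> rcases b with _ | b
    · simp [coord]; rfl
    · simp only [coord]
      simp
    · simp only [coord]
      simp
    · simp only [coord]
      simp only [Matrix.cons_val_zero, Matrix.cons_val_one]
      rw [mul_one, one_mul, sub_eq_zero]
      exact OnePoint.coe_eq_coe.symm
  let v : Fin 2 → Fin 2 ⊕ Fin 2 := fun k => if i = 0 then Sum.inl k else Sum.inr k
  have hF : MvPolynomial.IsWeightedHomogeneous bidegree
      (MvPolynomial.C (coord a 1) * MvPolynomial.X (v 0)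
        - MvPolynomial.C (coord a 0) * MvPolynomial.X (v 1)) (bidegree (v 0)) := by
    refine ((hX (v 0)).C_mul _).sub ?_
    have : bidegree (v 0) = bidegree (v 1) := by
      by_cases h : i = 0 <;> simp [v, h, bidegree]
    rw [this]
    exact (hX (v 1)).C_mul _
  convert isClosed_form hF using 3 with p
  rw [← hlin]
  by_cases h : i = 0 <;> simp [v, h, formEval, mul_comm]

lemma not_singleton {G : RatFunc ℂ} {hG : 2 ≤ degree G} (V : GraphComponent G hG) (p : P1 × P1)
    (hV : V.carrier = {p}) : False := by
  obtain ⟨a, b⟩ := p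
  obtain ⟨N, D, hND⟩ := exists_chart_fraction G a
  obtain ⟨M, E, hME⟩ := exists_chart_fraction G b
  let h : MvPolynomial (Fin 2) ℂ := Polynomial.aeval (MvPolynomial.X 0) N
      * Polynomial.aeval (MvPolynomial.X 1) E
    - Polynomial.aeval (MvPolynomial.X 1) M * Polynomial.aeval (MvPolynomial.X 0) D
  have hev : ∀ (f : Polynomial ℂ) (i : Fin 2) (w : Fin 2 → ℂ), MvPolynomial.eval w
      (Polynomial.aeval (MvPolynomial.X i : MvPolynomial (Fin 2) ℂ) f) = f.eval (w i) := by
    intro f i w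
    rw [← MvPolynomial.coe_aeval_eq_eval, RingHom.coe_coe, ← Polynomial.aeval_algHom_apply,
      MvPolynomial.aeval_X, Polynomial.coe_aeval_eq_eval]
  have hh : ∀ w, MvPolynomial.eval w h = 0 ↔
      toMap G (chart a (w 0)) = toMap G (chart b (w 1)) := by
    intro w
    simp only [h, map_sub, map_mul, hev]
    rcases hND (w 0) with ⟨h1, h2⟩ | ⟨h1, h2, h3⟩ <;>
      rcases hME (w 1) with ⟨k1, k2⟩ | ⟨k1, k2, k3⟩
    · rw [h2, k2, OnePoint.coe_eq_coe, div_eq_div_iff h1 k1, sub_eq_zero]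
    · rw [h2, k3]
      simp [k1, k2, h1]
    · rw [h3, k2]
      simp [h1, h2, k1]
    · rw [h3, k3]
      simp [h1, k1]
  have hp : ((a, b) : P1 × P1) ∈ graph G := V.maximal.prop.1 (hV ▸ rfl)
  have h0 : MvPolynomial.eval 0 h = 0 := by
    rw [hh]
    simp only [Pi.zero_apply, chart_zero]
    exact hp
  have hne : h ≠ 0 := by
    intro hz
    have hinf : Set.Infinite (Set.range (chart a)) := by
      refine Set.infinite_range_of_injective ?_
      intro u u' huu
      rcases a with _ | a
      · simp only [chart] at huu
        split_ifs at huu with h1 h2 h2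
        · rw [h1, h2]
        · exact absurd huu (OnePoint.infty_ne_coe _)
        · exact absurd huu (OnePoint.coe_ne_infty _)
        · exact inv_injective (OnePoint.coe_injective huu)
      · exact add_left_cancel (OnePoint.coe_injective huu)
    refine hinf ((finite_fiber hG (toMap G b)).subset ?_)
    rintro _ ⟨u, rfl⟩
    have := (hh ![u, 0]).mp (by rw [hz, map_zero])
    simpa [chart_zero] using this
  obtain ⟨s, hs, hsa⟩ := WfDvdMonoid.exists_factors h hne
  obtain ⟨q, hqs, hq0⟩ : ∃ q ∈ s, MvPolynomial.eval 0 q = 0 := by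
    have : MvPolynomial.eval 0 s.prod = 0 := by
      obtain ⟨c, hc⟩ := hsa.symm
      rw [← hc, map_mul, h0, zero_mul]
    rw [map_multiset_prod, Multiset.prod_eq_zero_iff, Multiset.mem_map] at this
    exact this
  have hqirr := hs q hqs
  have hqp : Prime q := hqirr.prime
  have hqh : q ∣ h := (Multiset.dvd_prod hqs).trans hsa.dvd
  have : (Ideal.span {q}).IsPrime := (Ideal.span_singleton_prime hqp.ne_zero).mpr hqp
  have hnull : ∀ f : MvPolynomial (Fin 2) ℂ,
      (∀ w, MvPolynomial.eval w q = 0 → MvPolynomial.eval w f = 0) → q ∣ f := by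
    intro f hf
    rw [← Ideal.mem_span_singleton,
      ← MvPolynomial.IsPrime.vanishingIdeal_zeroLocus (K := ℂ) (Ideal.span {q})]
    intro w hw
    exact hf w (hw q (Ideal.mem_span_singleton_self q))
  let φ : (Fin 2 → ℂ) → P1 × P1 := fun w => (chart a (w 0), chart b (w 1))
  have hpull : ∀ F m, MvPolynomial.IsWeightedHomogeneous bidegree F m →
      ∃ f : MvPolynomial (Fin 2) ℂ, ∀ w, MvPolynomial.eval w f = 0 ↔ formEval F (φ w) = 0 := by
    intro F m hF
    let c : Fin 2 ⊕ Fin 2 → MvPolynomial (Fin 2) ℂ := Sum.elim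
      ![Polynomial.aeval (MvPolynomial.X 0) (chartVec a).1,
        Polynomial.aeval (MvPolynomial.X 0) (chartVec a).2]
      ![Polynomial.aeval (MvPolynomial.X 1) (chartVec b).1,
        Polynomial.aeval (MvPolynomial.X 1) (chartVec b).2]
    refine ⟨MvPolynomial.bind₁ c F, fun w => ?_⟩
    obtain ⟨r, hr, hr'⟩ := chartVec_eval a (w 0)
    obtain ⟨t, ht, ht'⟩ := chartVec_eval b (w 1)
    have hc : (fun i => MvPolynomial.eval w (c i))
        = Sum.elim (r • coord (chart a (w 0))) (t • coord (chart b (w 1))) := by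
      rw [← hr', ← ht']
      funext i
      rcases i with i | i <;> fin_cases i <;> simp [c, hev]
    have : MvPolynomial.eval w (MvPolynomial.bind₁ c F)
        = MvPolynomial.eval (fun i => MvPolynomial.eval w (c i)) F := by
      rw [MvPolynomial.eval, MvPolynomial.eval₂Hom_bind₁]
      rfl
    rw [this, hc, formEval_scale hF]
    simp [hr, ht, formEval, φ]
  have hZ : @IsIrreducible _ zariski (φ '' {w | MvPolynomial.eval w q = 0}) := by
    refine ⟨⟨_, 0, hq0, rfl⟩, ?_⟩
    rintro U U' hU hU' ⟨_, ⟨w, hw, rfl⟩, hwU⟩ ⟨_, ⟨w', hw', rfl⟩, hwU'⟩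
    obtain ⟨F, m, hF, hFp, hFU⟩ := exists_form_of_isOpen hU _ hwU
    obtain ⟨F', m', hF', hFp', hFU'⟩ := exists_form_of_isOpen hU' _ hwU'
    obtain ⟨f, hf⟩ := hpull F m hF
    obtain ⟨f', hf'⟩ := hpull F' m' hF'
    by_contra hcon
    have hdvd : q ∣ f * f' := by
      refine hnull _ fun x hx => ?_
      by_contra hx0
      rw [map_mul] at hx0
      refine hcon ⟨φ x, ⟨x, hx, rfl⟩, hFU _ ?_, hFU' _ ?_⟩
      · exact fun h => left_ne_zero_of_mul hx0 ((hf x).mpr h)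
      · exact fun h => right_ne_zero_of_mul hx0 ((hf' x).mpr h)
    rcases hqp.dvd_or_dvd hdvd with ⟨g, rfl⟩ | ⟨g, rfl⟩
    · exact hFp ((hf w).mp (by rw [map_mul, hw, zero_mul]))
    · exact hFp' ((hf' w').mp (by rw [map_mul, hw', zero_mul]))
  have hZG : φ '' {w | MvPolynomial.eval w q = 0} ⊆ graph G := by
    rintro _ ⟨w, hw, rfl⟩
    obtain ⟨g, hg⟩ := hqh
    exact (hh w).mp (by rw [hg, map_mul, hw, zero_mul])
  have hle := V.maximal.le_of_ge ⟨hZG, hZ⟩ (by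
    rw [hV]
    rintro _ rfl
    exact ⟨0, hq0, by simp [φ, chart_zero]⟩)
  have hzero : ∀ w, MvPolynomial.eval w q = 0 → w 0 = 0 ∧ w 1 = 0 := by
    intro w hw
    have := hle ⟨w, hw, rfl⟩
    rw [hV] at this
    have := Prod.mk.inj this
    exact ⟨eq_zero_of_chart_eq this.1, eq_zero_of_chart_eq this.2⟩
  obtain ⟨g, hg⟩ := hnull (MvPolynomial.X 0) (fun w hw => by simpa using (hzero w hw).1)
  obtain ⟨g', hg'⟩ := hnull (MvPolynomial.X 1) (fun w hw => by simpa using (hzero w hw).2)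
  have hX0 : Irreducible (MvPolynomial.X 0 : MvPolynomial (Fin 2) ℂ) := MvPolynomial.X_prime.irreducible
  have hgu : IsUnit g := (hX0.isUnit_or_isUnit hg).resolve_left hqirr.not_isUnit
  obtain ⟨g1, hg1⟩ := hgu.exists_right_inv
  have hbad : (MvPolynomial.X 1 : MvPolynomial (Fin 2) ℂ) = MvPolynomial.X 0 * (g1 * g') := by
    rw [hg, hg']
    linear_combination (-(q * g')) * hg1
  have := congrArg (MvPolynomial.eval ![(0 : ℂ), 1]) hbad
  simp at this

lemma affinePart_nonempty {G : RatFunc ℂ} {hG : 2 ≤ degree G} (V : GraphComponent G hG) :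
    (affinePart V.carrier).Nonempty := by
  let _ := zariski
  have hirr : IsIrreducible V.carrier := V.maximal.prop.2
  have hfin : ∀ i : Fin 2, ∀ T : Set P1, T.Finite →
      V.carrier ⊆ {p | (if i = 0 then p.1 else p.2) ∈ T} →
      ∃ a, V.carrier ⊆ {p | (if i = 0 then p.1 else p.2) = a} := by
    classical
    intro i T hT hsub
    obtain ⟨Z, hZ, hVZ⟩ := isIrreducible_iff_sUnion_isClosed.mp hirr
      (hT.toFinset.image fun a => {p : P1 × P1 | (if i = 0 then p.1 else p.2) = a})
      (by
        intro z hz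
        obtain ⟨a, _, rfl⟩ := Finset.mem_image.mp hz
        exact isClosed_coord i a)
      (by
        intro p hp
        exact ⟨_, Finset.mem_coe.mpr (Finset.mem_image_of_mem _ (hT.mem_toFinset.mpr (hsub hp))),
          rfl⟩)
    obtain ⟨a, _, rfl⟩ := Finset.mem_image.mp hZ
    exact ⟨a, hVZ⟩
  by_contra hemp
  have hcov : V.carrier ⊆ {p : P1 × P1 | p.1 = OnePoint.infty} ∪ {p | p.2 = OnePoint.infty} := by
    rintro ⟨x, y⟩ hp
    rcases x with _ | x
    · exact Or.inl rfl
    rcases y with _ | y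
    · exact Or.inr rfl
    exact absurd ⟨![x, y], hp⟩ hemp
  obtain ⟨⟨x0, y0⟩, hp0⟩ := hirr.nonempty
  have hend : ∀ x y : P1, V.carrier ⊆ {p | p.1 = x} → V.carrier ⊆ {p | p.2 = y} → False := by
    intro x y hx hy
    refine not_singleton V (x0, y0) (Set.Subset.antisymm ?_ (by rintro _ rfl; exact hp0))
    rintro ⟨x', y'⟩ hp
    have h1 : x0 = x := hx hp0
    have h2 : x' = x := hx hp
    have h3 : y0 = y := hy hp0
    have h4 : y' = y := hy hp
    rw [h1, h2, h3, h4]; rfl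
  rcases isPreirreducible_iff_isClosed_union_isClosed.mp hirr.isPreirreducible _ _
    (by simpa using isClosed_coord 0 OnePoint.infty)
    (by simpa using isClosed_coord 1 OnePoint.infty) hcov with h | h
  · obtain ⟨y, hy⟩ := hfin 1 _ (finite_fiber hG (toMap G OnePoint.infty)) (by
      intro p hp
      have h1 : toMap G p.1 = toMap G p.2 := V.maximal.prop.1 hp
      have h2 : p.1 = OnePoint.infty := h hp
      simpa [h2] using h1.symm)
    exact hend _ y h (by simpa using hy)
  · obtain ⟨x, hx⟩ := hfin 0 _ (finite_fiber hG (toMap G OnePoint.infty)) (by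
      intro p hp
      have h1 : toMap G p.1 = toMap G p.2 := V.maximal.prop.1 hp
      have h2 : p.2 = OnePoint.infty := h hp
      simpa [h2] using h1)
    exact hend x _ (by simpa using hx) h

/-! ### The normalization of a component and its genus -/

namespace GraphComponent

variable {G : RatFunc ℂ} {hG : 2 ≤ degree G} (V : GraphComponent G hG)

/-- The ideal in `ℂ[x, y]` of the affine part `V ∩ ℂ²`. -/
def ideal : Ideal (MvPolynomial (Fin 2) ℂ) :=
  MvPolynomial.vanishingIdeal ℂ (affinePart V.carrier)

instance isPrime_ideal : V.ideal.IsPrime := by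
  let _ := zariski
  obtain ⟨w0, hw0⟩ := affinePart_nonempty V
  refine ⟨fun htop => ?_, fun {f g} hfg => ?_⟩
  · have : (1 : MvPolynomial (Fin 2) ℂ) ∈ V.ideal := htop ▸ Submodule.mem_top
    simpa using this w0 hw0
  · have hirr : IsIrreducible V.carrier := V.maximal.prop.2
    by_contra hcon
    rw [not_or] at hcon
    obtain ⟨F, m, hF, hF'⟩ := exists_homogenization f
    obtain ⟨H, n, hH, hH'⟩ := exists_homogenization g
    let L : MvPolynomial (Fin 2 ⊕ Fin 2) ℂ :=
      MvPolynomial.X (Sum.inl 1) * MvPolynomial.X (Sum.inr 1)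
    have hL : L.IsWeightedHomogeneous bidegree _ :=
      (MvPolynomial.isWeightedHomogeneous_X ℂ bidegree (Sum.inl 1)).mul
        (MvPolynomial.isWeightedHomogeneous_X ℂ bidegree (Sum.inr 1))
    have hLa : ∀ w : Fin 2 → ℂ, formEval L ((w 0 : P1), (w 1 : P1)) = 1 := by
      intro w
      simp only [L, formEval, map_mul, MvPolynomial.eval_X, Sum.elim_inl, Sum.elim_inr]
      exact mul_one 1
    have hex : ∀ (f : MvPolynomial (Fin 2) ℂ), f ∉ V.ideal →
        ∃ w ∈ affinePart V.carrier, MvPolynomial.eval w f ≠ 0 := by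
      intro f hf
      by_contra h
      push Not at h
      exact hf h
    obtain ⟨w, hw, hwf⟩ := hex f hcon.1
    obtain ⟨w', hw', hwg⟩ := hex g hcon.2
    obtain ⟨⟨x, y⟩, hxy, h1, h2⟩ := hirr.2 _ _ (isOpen_form (hF.mul hL)) (isOpen_form hH)
      ⟨_, hw, by simpa [formEval_mul, hF', hLa] using hwf⟩
      ⟨_, hw', by simpa [hH'] using hwg⟩
    simp only [Set.mem_ofPred_eq, formEval_mul] at h1 h2
    rcases x with _ | x
    · exact right_ne_zero_of_mul h1 (by simp [L, formEval, coord])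
    rcases y with _ | y
    · exact right_ne_zero_of_mul h1 (by simp [L, formEval, coord])
    have h3 : MvPolynomial.eval ![x, y] f ≠ 0 := by
      rw [← hF']; exact left_ne_zero_of_mul h1
    have h4 : MvPolynomial.eval ![x, y] g ≠ 0 := by
      rw [← hH']; exact h2
    have h5 := hfg ![x, y] hxy
    rw [map_mul] at h5
    exact mul_ne_zero h3 h4 h5

/-- The function field `ℂ(V)`, the field of fractions of the coordinate ring of `V ∩ ℂ²`. -/
abbrev FunctionField : Type := FractionRing (MvPolynomial (Fin 2) ℂ ⧸ V.ideal)

/-- The coordinate functions `x` (`i = 0`) and `y` (`i = 1`), as elements of `ℂ(V)`. -/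
def coordFun (i : Fin 2) : V.FunctionField :=
  algebraMap (MvPolynomial (Fin 2) ℂ ⧸ V.ideal) V.FunctionField
    (Ideal.Quotient.mk V.ideal (MvPolynomial.X i))

/-- For a coordinate function `f`, a function defining the point `f = a` on `ℙ¹` near it. -/
def localParam (f : V.FunctionField) : P1 → V.FunctionField
  | none => f⁻¹
  | some a => f - algebraMap ℂ V.FunctionField a

/-- A point of the normalization of `V`: a point `(a, b)` of `V` with a normalized discrete
valuation of `ℂ(V)`, trivial on `ℂ`, whose valuation ring dominates the local ring of `V` at
`(a, b)`. That local ring is the localization of `ℂ[s, t]` at the maximal ideal `(s, t)`, where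
`s` and `t` are the parameters `localParam` at `a` and `b`, so domination means that `s` and `t`
have positive order. (The valuation rings which dominate the local ring of `V` at a point are the
localizations of its integral closure in `ℂ(V)` at the maximal ideals.) -/
structure NormalizationPoint where
  image : P1 × P1
  image_mem : image ∈ V.carrier
  val : Valuation V.FunctionField ℤᵐ⁰
  surjective : Function.Surjective val
  trivialOn : val.IsTrivialOn ℂ
  fst_lt_one : val (V.localParam (V.coordFun 0) image.1) < 1
  snd_lt_one : val (V.localParam (V.coordFun 1) image.2) < 1

/-- Divisors on the normalization of `V`. -/
abbrev NormalizationDivisor : Type := V.NormalizationPoint →₀ ℤ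

/-- The degree of a divisor. -/
def divisorDegree (D : V.NormalizationDivisor) : ℤ := D.sum fun _ n => n

/-- The Riemann-Roch space `L(D)` of the functions `f` with `ord_P f ≥ -D(P)` at every point `P`
of the normalization. (In terms of the order, `val f = exp (-ord_P f)`.) -/
def riemannRochSpace (D : V.NormalizationDivisor) : Submodule ℂ V.FunctionField where
  carrier := {f | ∀ P : V.NormalizationPoint, P.val f ≤ WithZero.exp (D P)}
  zero_mem' P := by simp
  add_mem' {f g} hf hg P := (P.val.map_add f g).trans (max_le (hf P) (hg P))
  smul_mem' c f hf P := by
    by_cases hc : c = 0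
    · simp [hc]
    · rw [Algebra.smul_def, map_mul, P.trivialOn.eq_one c hc, one_mul]
      exact hf P

/-- The genus of the normalization of `V`: the maximum, over all divisors `D`, of
`deg D - dim L(D) + 1`. -/
def genus : ℕ∞ :=
  ⨆ D : V.NormalizationDivisor,
    ((V.divisorDegree D - (Module.finrank ℂ (V.riemannRochSpace D) : ℤ) + 1).toNat : ℕ∞)

/-! ### Branches of the multi-valued function with graph `V` -/

/-- `b` is (a representative of) a holomorphic germ at `w₀` of the multi-valued function
`G⁻¹ ∘ G` whose graph is `V`: near `w₀`, its graph lies in `V`. (In particular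
`G ∘ b = G` near `w₀`.) -/
def IsBranch (b : ℂ → ℂ) (w₀ : ℂ) : Prop :=
  AnalyticAt ℂ b w₀ ∧ ∀ᶠ w : ℂ in 𝓝 w₀, ((w : P1), (b w : P1)) ∈ V.carrier

/-- The equation `(G⁻¹ ∘ G) ∘ g = f` for the multi-valued function `G⁻¹ ∘ G` with graph `V`: some
branch `b` of it satisfies `b ∘ g = f` on a nonempty open set. -/
def BranchCompEq (g f : RatFunc ℂ) : Prop :=
  ∃ (z₀ w₀ : ℂ) (b : ℂ → ℂ), toMap g (z₀ : P1) = (w₀ : P1) ∧ V.IsBranch b w₀ ∧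
    ∀ᶠ z : ℂ in 𝓝 z₀, ∃ w : ℂ, toMap g (z : P1) = (w : P1) ∧ toMap f (z : P1) = (b w : P1)

/-- `z ↦ (g z, f z)` is a rational parametrization of `V`: it maps `ℙ¹` onto `V`, and it is
injective outside a finite set. -/
def IsRationalParametrization (g f : RatFunc ℂ) : Prop :=
  Set.range (fun z : P1 => (toMap g z, toMap f z)) = V.carrier ∧
    ∃ E : Set P1, E.Finite ∧ Set.InjOn (fun z : P1 => (toMap g z, toMap f z)) Eᶜ

end GraphComponent

end RatCorr

end

/-!
The equivalence holds because each of the three conditions says that the function field `ℂ(V)` is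
isomorphic to `ℂ(t)`. Everything is expressed by places: valuations of `ℂ(V)` that are trivial on
`ℂ`, together with the relation `HasValue v f a`, "the function `f` takes the value `a ∈ ℙ¹` at
`v`". Since `ℂ(V)` has transcendence degree one over an algebraically closed field, each function
has exactly one value at each nontrivial place (`exists_hasValue`, `HasValue.unique`), and rational
expressions are evaluated place by place (`HasValue.map`, `hasValue_mvPolynomial_aeval`). A point of
`ℙ¹ × ℙ¹` lies on `V` precisely if it is the pair of values of `x` and `y` at some place
(`exists_place_of_mem`, `mem_carrier_of_hasValue`); the former is the existence of valuation rings
that dominate a given local ring, and it also shows that `V` is Zariski closed.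

Genus zero gives a function `t` with one simple pole, at `P` say: it lies in `L(P)`, whose dimension
is at least two. By induction on the order of the pole, the functions with poles only at `P` are the
polynomials in `t`, because a function without poles is constant (`exists_pole`). Any function
becomes integral over `ℂ[t]` after multiplication by a nonzero polynomial in `t`, so
`ℂ(V) = ℂ(t)` (`surjective_of_simple_pole`). Conversely, if `ℂ(V) = ℂ(t)`, the discrete places are
determined by the value of `t`, and multiplying the polynomials in `t` of degree at most `deg D` by
`∏ (t - t(P)) ^ (-D(P))` gives `deg D + 1` independent elements of `L(D)`, which has finite
dimension (`exists_multiplier`, `finiteDimensional_riemannRochSpace`).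

If `x = g(t)` and `y = f(t)` in `ℂ(V) = ℂ(t)`, then `(g, f)` parametrizes `V`, by the description of
the points of `V` by places; it is injective outside a finite set because `t` is a rational
expression in `x` and `y`. A parametrization yields the branch `f ∘ g⁻¹` at a noncritical value of
`g`. Finally, an equation `b ∘ g = f` for a branch `b` shows that `(g, f)` satisfies the equations
of `V` on an open set, hence identically, so it embeds `ℂ(V)` into `ℂ(z)`, and Lüroth's theorem
applies.
-/

noncomputable section

namespace RatCorr

/-! ### Values of functions at places -/

section Places

open Polynomial

variable {K Γ : Type*} [Field K] [Algebra ℂ K] [LinearOrderedCommGroupWithZero Γ]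

/-- The function `f` takes the value `a` at the place `v`: the difference `f - a` vanishes there,
or `a = ∞` and `f` has a pole. (Unlike `f⁻¹` having positive order, this is right for `f = 0`.) -/
def HasValue (v : Valuation K Γ) (f : K) : P1 → Prop
  | none => 1 < v f
  | some a => v (f - algebraMap ℂ K a) < 1

variable {v : Valuation K Γ}

lemma hasValue_infty {f : K} : HasValue v f OnePoint.infty ↔ 1 < v f := Iff.rfl

lemma hasValue_coe {f : K} {a : ℂ} :
    HasValue v f (a : P1) ↔ v (f - algebraMap ℂ K a) < 1 := Iff.rfl

lemma HasValue.le_one [v.IsTrivialOn ℂ] {f : K} {a : ℂ} (h : HasValue v f (a : P1)) :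
    v f ≤ 1 := by
  have h2 := v.map_add (f - algebraMap ℂ K a) (algebraMap ℂ K a)
  rw [sub_add_cancel] at h2
  exact h2.trans (max_le (le_of_lt h) (Valuation.IsTrivialOn.valuation_algebraMap_le_one v a))

lemma HasValue.unique [v.IsTrivialOn ℂ] {f : K} {a b : P1} (ha : HasValue v f a)
    (hb : HasValue v f b) : a = b := by
  induction a using OnePoint.rec with
  | infty =>
    induction b using OnePoint.rec with
    | infty => rfl
    | coe b => exact absurd hb.le_one (not_le.mpr ha)
  | coe a =>
    induction b using OnePoint.rec with
    | infty => exact absurd ha.le_one (not_le.mpr hb)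
    | coe b =>
      by_contra hab
      have hne : b - a ≠ 0 := fun h => hab (by rw [sub_eq_zero.mp h])
      have h1 : v (algebraMap ℂ K (b - a)) = 1 := Valuation.IsTrivialOn.eq_one _ hne
      have h2 := v.map_sub_lt (hasValue_coe.mp ha) (hasValue_coe.mp hb)
      rw [sub_sub_sub_cancel_left, ← map_sub, h1] at h2
      exact lt_irrefl _ h2

/-- Factor a polynomial in `t` into linear factors. -/
lemma val_aeval [v.IsTrivialOn ℂ] (t : K) {p : ℂ[X]} (hp : p ≠ 0) :
    v (aeval t p) = (p.roots.map fun r => v (t - algebraMap ℂ K r)).prod := by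
  conv_lhs => rw [(IsAlgClosed.splits p).eq_prod_roots]
  rw [map_mul, map_mul, aeval_C, Valuation.IsTrivialOn.eq_one _ (leadingCoeff_ne_zero.mpr hp),
    one_mul, map_multiset_prod, map_multiset_prod, Multiset.map_map, Multiset.map_map]
  simp [Function.comp_def]

/-- A value at a place of a polynomial expression in functions with finite values. -/
lemma hasValue_mvPolynomial_aeval [v.IsTrivialOn ℂ] {σ : Type*} {f : σ → K} {a : σ → ℂ}
    (h : ∀ i, HasValue v (f i) (a i : P1)) (p : MvPolynomial σ ℂ) :
    HasValue v (MvPolynomial.aeval f p) ((MvPolynomial.eval a p : ℂ) : P1) := by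
  rw [hasValue_coe]
  induction p using MvPolynomial.induction_on with
  | C c => simp
  | add p q hp hq =>
    rw [map_add, map_add, map_add, add_sub_add_comm]
    exact v.map_add_lt hp hq
  | mul_X p i hp =>
    have key : MvPolynomial.aeval f (p * MvPolynomial.X i)
          - algebraMap ℂ K (MvPolynomial.eval a (p * MvPolynomial.X i))
        = (MvPolynomial.aeval f p - algebraMap ℂ K (MvPolynomial.eval a p)) * f i
          + algebraMap ℂ K (MvPolynomial.eval a p) * (f i - algebraMap ℂ K (a i)) := by
      simp only [map_mul, MvPolynomial.aeval_X, MvPolynomial.eval_X]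
      ring
    rw [key]
    refine v.map_add_lt ?_ ?_
    · rw [map_mul]
      exact mul_lt_one_of_nonneg_of_lt_one_left zero_le hp (h i).le_one
    · rw [map_mul]
      exact mul_lt_one_of_nonneg_of_lt_one_right
        (Valuation.IsTrivialOn.valuation_algebraMap_le_one v _) zero_le (h i)

lemma hasValue_aeval [v.IsTrivialOn ℂ] {t : K} {c : ℂ} (h : HasValue v t (c : P1)) (p : ℂ[X]) :
    HasValue v (aeval t p) ((p.eval c : ℂ) : P1) := by
  have := hasValue_mvPolynomial_aeval (v := v) (σ := Unit) (f := fun _ => t) (a := fun _ => c)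
    (fun _ => h) (aeval (MvPolynomial.X ()) p)
  rwa [← aeval_algHom_apply, MvPolynomial.aeval_X, ← MvPolynomial.coe_aeval_eq_eval,
    RingHom.coe_coe, ← aeval_algHom_apply, MvPolynomial.aeval_X, coe_aeval_eq_eval] at this

lemma val_sub_eq_one [v.IsTrivialOn ℂ] {t : K} {b c : ℂ} (h : HasValue v t (c : P1))
    (hbc : b ≠ c) : v (t - algebraMap ℂ K b) = 1 := by
  refine le_antisymm ?_ (not_lt.mp fun hlt => hbc ?_)
  · exact (v.map_sub _ _).trans
      (max_le h.le_one (Valuation.IsTrivialOn.valuation_algebraMap_le_one v _))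
  · exact OnePoint.coe_injective ((hasValue_coe.mpr hlt).unique h)

lemma val_eq_one [v.IsTrivialOn ℂ] {f : K} {b : ℂ} (h : HasValue v f (b : P1))
    (hb : b ≠ 0) : v f = 1 := by
  simpa using val_sub_eq_one h hb.symm

lemma val_sub_eq_of_pole [v.IsTrivialOn ℂ] {t : K} (h : 1 < v t) (b : ℂ) :
    v (t - algebraMap ℂ K b) = v t :=
  Valuation.map_sub_eq_of_lt_left v
    ((Valuation.IsTrivialOn.valuation_algebraMap_le_one v _).trans_lt h)

lemma val_aeval_of_pole [v.IsTrivialOn ℂ] {t : K} (h : 1 < v t) {p : ℂ[X]} (hp : p ≠ 0) :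
    v (aeval t p) = v t ^ p.natDegree := by
  simp [val_aeval t hp, val_sub_eq_of_pole h, (IsAlgClosed.splits p).natDegree_eq_card_roots]

/-- Residue fields of places at which everything is algebraic over `ℂ(t)` are `ℂ`: a function `t`
whose value is not in `ℙ¹` would make every nonzero polynomial in `t` a unit, hence the place
trivial. -/
lemma exists_hasValue [v.IsTrivialOn ℂ] {t : K}
    (halg : ∀ s : K, IsAlgebraic (Algebra.adjoin ℂ {t}) s)
    (hnt : ∃ s : K, s ≠ 0 ∧ v s < 1) : ∃ a, HasValue v t a := by
  by_contra! hno
  have hle : v t ≤ 1 := not_lt.mp (hno OnePoint.infty)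
  have hone : ∀ c : ℂ, v (t - algebraMap ℂ K c) = 1 := fun c =>
    le_antisymm ((v.map_sub _ _).trans
      (max_le hle (Valuation.IsTrivialOn.valuation_algebraMap_le_one v _))) (not_lt.mp (hno c))
  have hunit : ∀ r : Algebra.adjoin ℂ {t}, r ≠ 0 → v (r : K) = 1 := by
    rintro ⟨r, hr⟩ hr0
    rw [Algebra.adjoin_singleton_eq_range_aeval] at hr
    obtain ⟨p, rfl⟩ := hr
    have hp : p ≠ 0 := by
      rintro rfl
      exact hr0 (Subtype.ext (map_zero (aeval t)))
    exact (val_aeval t hp).trans (by simp [hone])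
  obtain ⟨s, hs0, hs⟩ := hnt
  obtain ⟨q, hq0, hq⟩ := (halg s).exists_nonzero_coeff_and_aeval_eq_zero
    (mem_nonZeroDivisors_of_ne_zero hs0)
  have hle1 : ∀ r : Algebra.adjoin ℂ {t}, v (r : K) ≤ 1 := fun r => by
    by_cases hr : r = 0
    · simp [hr]
    · exact (hunit r hr).le
  have hint : ∀ q : (Algebra.adjoin ℂ {t})[X], v (aeval s q) ≤ 1 := by
    intro q
    rw [aeval_eq_sum_range]
    refine v.map_sum_le fun i _ => ?_
    rw [Algebra.smul_def, map_mul, map_pow]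
    exact mul_le_one' (hle1 _) (pow_le_one' hs.le i)
  have h0 : aeval s q = s * aeval s q.divX + (q.coeff 0 : K) := by
    conv_lhs => rw [← X_mul_divX_add q]
    rw [map_add, map_mul, aeval_X, aeval_C]
    rfl
  rw [hq] at h0
  have h1 : (q.coeff 0 : K) = -(s * aeval s q.divX) := by linear_combination -h0
  have h2 := hunit _ hq0
  rw [h1, Valuation.map_neg, map_mul] at h2
  exact (mul_lt_one_of_nonneg_of_lt_one_left zero_le hs (hint _)).ne h2

lemma exists_const_of_not_transcendental {f : K} (hf : ¬ Transcendental ℂ f) :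
    ∃ c : ℂ, f = algebraMap ℂ K c := by
  rw [Transcendental, not_not] at hf
  have h1 := IsAlgClosed.degree_eq_one_of_irreducible ℂ (minpoly.irreducible hf.isIntegral)
  obtain ⟨c, hc⟩ := minpoly.mem_range_of_degree_eq_one ℂ f h1
  exact ⟨c, hc.symm⟩

lemma map_algebraMap_eq_aeval (φ : RatFunc ℂ →ₐ[ℂ] K) (p : ℂ[X]) :
    φ (algebraMap ℂ[X] (RatFunc ℂ) p) = aeval (φ RatFunc.X) p := by
  rw [← RatFunc.algebraMap_X, aeval_algHom_apply, aeval_algebraMap_apply]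
  simp

lemma map_eq_aeval_div (φ : RatFunc ℂ →ₐ[ℂ] K) (g : RatFunc ℂ) :
    φ g = aeval (φ RatFunc.X) g.num / aeval (φ RatFunc.X) g.denom := by
  conv_lhs => rw [← RatFunc.num_div_denom g]
  rw [map_div₀, map_algebraMap_eq_aeval, map_algebraMap_eq_aeval]

/-- If `t` takes the value `c` at a place of `ℂ(t)`, then `g(t)` takes the value `g(c)`. -/
lemma HasValue.map [v.IsTrivialOn ℂ] {φ : RatFunc ℂ →ₐ[ℂ] K} {c : P1}
    (h : HasValue v (φ RatFunc.X) c) (g : RatFunc ℂ) : HasValue v (φ g) (toMap g c) := by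
  set t := φ RatFunc.X
  have hpoly := map_algebraMap_eq_aeval φ
  have hg := map_eq_aeval_div φ g
  have hd0 : aeval t g.denom ≠ 0 := by
    rw [← hpoly, _root_.map_ne_zero]
    exact RatFunc.algebraMap_ne_zero g.denom_ne_zero
  have hvd0 : 0 < v (aeval t g.denom) := zero_lt_iff.mpr ((Valuation.ne_zero_iff v).mpr hd0)
  have hsub : ∀ q : ℂ, φ g - algebraMap ℂ K q
      = aeval t (g.num - C q * g.denom) / aeval t g.denom := by
    intro q
    rw [hg, div_sub' hd0, map_sub, map_mul, aeval_C, mul_comm]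
  induction c using OnePoint.rec with
  | infty =>
    rw [hasValue_infty] at h
    by_cases hdeg : g.denom.natDegree < g.num.natDegree
    · have hT : toMap g OnePoint.infty = OnePoint.infty := if_pos hdeg
      have hn0 : g.num ≠ 0 := by
        intro h0
        simp [h0] at hdeg
      rw [hT, hasValue_infty, hg, map_div₀, one_lt_div₀ hvd0,
        val_aeval_of_pole h g.denom_ne_zero, val_aeval_of_pole h hn0]
      exact pow_lt_pow_right₀ h hdeg
    · have hT : toMap g OnePoint.infty = ((g.num.coeff g.denom.natDegree /
          g.denom.coeff g.denom.natDegree : ℂ) : P1) := if_neg hdeg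
      rw [hT, hasValue_coe, hsub, map_div₀, div_lt_one₀ hvd0,
        val_aeval_of_pole h g.denom_ne_zero]
      set q := g.num.coeff g.denom.natDegree / g.denom.coeff g.denom.natDegree with hq
      have hlc : g.denom.coeff g.denom.natDegree ≠ 0 := leadingCoeff_ne_zero.mpr g.denom_ne_zero
      by_cases hr : g.num - C q * g.denom = 0
      · rw [hr]
        simpa using pow_pos (zero_lt_one.trans h) _
      · rw [val_aeval_of_pole h hr]
        refine pow_lt_pow_right₀ h (lt_of_le_of_ne ?_ fun he => ?_)
        · exact (natDegree_sub_le _ _).trans (max_le (not_lt.mp hdeg) (natDegree_C_mul_le _ _))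
        · refine hr (leadingCoeff_eq_zero.mp ?_)
          rw [leadingCoeff, he, coeff_sub, coeff_C_mul, hq, div_mul_cancel₀ _ hlc, sub_self]
  | coe c =>
    have hn := hasValue_aeval h g.num
    have hd := hasValue_aeval h g.denom
    by_cases hz : g.denom.eval c = 0
    · have hT : toMap g (c : P1) = OnePoint.infty := if_pos hz
      rw [hz, hasValue_coe, map_zero, sub_zero] at hd
      rw [hT, hasValue_infty, hg, map_div₀, one_lt_div₀ hvd0,
        val_eq_one hn (not_both_zero g c hz)]
      exact hd
    · have hT : toMap g (c : P1) = ((g.num.eval c / g.denom.eval c : ℂ) : P1) := if_neg hz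
      have hr := hasValue_aeval h (g.num - C (g.num.eval c / g.denom.eval c) * g.denom)
      rw [hT, hasValue_coe, hsub, map_div₀, val_eq_one hd hz, div_one]
      simpa [hasValue_coe, div_mul_cancel₀ _ hz] using hr

end Places

/-! ### Existence of discrete places -/

section Existence

open Polynomial

variable {K : Type*} [Field K] [Algebra ℂ K]

lemma isAlgebraic_adjoin_of_trdeg_le (hK : Algebra.trdeg ℂ K ≤ 1) {t : K}
    (ht : Transcendental ℂ t) (s : K) : IsAlgebraic (Algebra.adjoin ℂ {t}) s := by
  have h1 : AlgebraicIndependent ℂ ((↑) : ({t} : Set K) → K) :=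
    (algebraicIndependent_singleton_iff (⟨t, rfl⟩ : ({t} : Set K))).mpr ht
  have h2 := h1.isTranscendenceBasis_of_trdeg_le_of_finite (by simpa using hK)
  have h3 := h2.isAlgebraic
  rw [Subtype.range_coe] at h3
  exact h3.isAlgebraic s

lemma isTrivialOn_of_le_one {Γ : Type*} [LinearOrderedCommGroupWithZero Γ] {v : Valuation K Γ}
    (h : ∀ c : ℂ, v (algebraMap ℂ K c) ≤ 1) : v.IsTrivialOn ℂ := by
  refine ⟨fun c hc => le_antisymm (h c) ?_⟩
  have h1 := h c⁻¹
  rw [map_inv₀, map_inv₀] at h1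
  exact (inv_le_one₀ (zero_lt_iff.mpr (by simpa using hc))).mp h1

lemma exists_valuation_lt_one_of_isDedekindDomain {B : Type*} [CommRing B] [IsDedekindDomain B]
    [Algebra ℂ B] [Algebra B K] [IsScalarTower ℂ B K] [IsFractionRing B K] {b : B} (hb0 : b ≠ 0)
    (hb : ¬ IsUnit b) :
    ∃ v : Valuation K ℤᵐ⁰, Function.Surjective v ∧ v.IsTrivialOn ℂ ∧ v (algebraMap B K b) < 1 := by
  obtain ⟨M, hM, hbM⟩ := exists_max_ideal_of_mem_nonunits hb
  let P : IsDedekindDomain.HeightOneSpectrum B :=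
    ⟨M, hM.isPrime, fun h => hb0 (by simpa [h] using hbM)⟩
  refine ⟨P.valuation K, P.valuation_surjective K, isTrivialOn_of_le_one fun c => ?_,
    (P.valuation_lt_one_iff_mem b).mpr hbM⟩
  rw [IsScalarTower.algebraMap_apply ℂ B K]
  exact P.valuation_le_one _

/-- A nonunit `s` of a principal ideal domain `A` has positive order at a discrete valuation of any
finite extension `K` of the field of fractions of `A`: take a prime over `(s)` of the integral
closure. -/
lemma exists_valuation_lt_one {A : Type*} [CommRing A] [IsDomain A] [IsPrincipalIdealRing A]
    [Algebra ℂ A] [Algebra A K] [IsScalarTower ℂ A K] [FaithfulSMul A K] [Algebra.IsAlgebraic A K]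
    [Algebra.EssFiniteType ℂ K] {s : A} (hs0 : s ≠ 0) (hs : ¬ IsUnit s) :
    ∃ v : Valuation K ℤᵐ⁰, Function.Surjective v ∧ v.IsTrivialOn ℂ ∧ v (algebraMap A K s) < 1 := by
  let _ : Algebra (FractionRing A) K := FractionRing.liftAlgebra A K
  have : IsScalarTower ℂ (FractionRing A) K := .of_algebraMap_eq fun x => by
    rw [IsScalarTower.algebraMap_apply ℂ A (FractionRing A), IsScalarTower.algebraMap_apply ℂ A K,
      IsScalarTower.algebraMap_apply A (FractionRing A) K]
  have : Algebra.IsAlgebraic (FractionRing A) K :=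
    IsFractionRing.comap_isAlgebraic_iff (A := A).mp inferInstance
  have : Algebra.EssFiniteType (FractionRing A) K :=
    Algebra.EssFiniteType.of_comp ℂ (FractionRing A) K
  have : FiniteDimensional (FractionRing A) K := Algebra.finite_of_essFiniteType_of_isAlgebraic
  have : CharZero (FractionRing A) :=
    charZero_of_injective_algebraMap (algebraMap ℂ (FractionRing A)).injective
  have : IsDedekindDomain (integralClosure A K) :=
    integralClosure.isDedekindDomain A (FractionRing A) K
  have : IsFractionRing (integralClosure A K) K :=
    integralClosure.isFractionRing_of_finite_extension (FractionRing A) K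
  have hloc : IsLocalHom (algebraMap A (integralClosure A K)) :=
    Algebra.IsIntegral.isLocalHom A (integralClosure A K)
  have h0 : algebraMap A (integralClosure A K) s ≠ 0 := fun h => hs0 <|
    FaithfulSMul.algebraMap_injective A K (by simpa using congrArg (algebraMap _ K) h)
  have := exists_valuation_lt_one_of_isDedekindDomain (K := K) h0
    fun hu => hs (hloc.map_nonunit s hu)
  exact this

lemma exists_discrete_place_zero [Algebra.EssFiniteType ℂ K] (hK : Algebra.trdeg ℂ K ≤ 1) {s : K}
    (hs : Transcendental ℂ s) : ∃ v : Valuation K ℤᵐ⁰, Function.Surjective v ∧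
      v.IsTrivialOn ℂ ∧ v s < 1 := by
  let e : ℂ[X] ≃ₐ[ℂ] Algebra.adjoin ℂ {s} :=
    (AlgEquiv.ofInjective (aeval s) (transcendental_iff_injective.mp hs)).trans
      (Subalgebra.equivOfEq _ _ (Algebra.adjoin_singleton_eq_range_aeval ℂ s).symm)
  have hes : (e X : K) = s := by simp [e]
  have : IsPrincipalIdealRing (Algebra.adjoin ℂ {s}) :=
    IsPrincipalIdealRing.of_surjective e.toRingEquiv.toRingHom e.surjective
  have : Algebra.IsAlgebraic (Algebra.adjoin ℂ {s}) K := ⟨isAlgebraic_adjoin_of_trdeg_le hK hs⟩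
  obtain ⟨v, h1, h2, h3⟩ := exists_valuation_lt_one (K := K) (s := e X)
    ((map_ne_zero_iff e e.injective).mpr X_ne_zero)
    (fun h => not_isUnit_X ((MulEquiv.isUnit_map e).mp h))
  rw [← hes]
  exact ⟨v, h1, h2, h3⟩

lemma exists_discrete_place_pole [Algebra.EssFiniteType ℂ K] (hK : Algebra.trdeg ℂ K ≤ 1) {s : K}
    (hs : Transcendental ℂ s) : ∃ v : Valuation K ℤᵐ⁰, Function.Surjective v ∧
      v.IsTrivialOn ℂ ∧ 1 < v s := by
  have hs' : Transcendental ℂ s⁻¹ := fun h => hs (by simpa using h.inv)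
  obtain ⟨v, h1, h2, h3⟩ := exists_discrete_place_zero hK hs'
  have hs0 : s ≠ 0 := fun h => hs (h ▸ isAlgebraic_zero)
  rw [map_inv₀, inv_lt_one₀ (zero_lt_iff.mpr (by simpa using hs0))] at h3
  exact ⟨v, h1, h2, h3⟩

/-- If the functions `s i` satisfy no polynomial relation with nonzero constant term, they vanish
at a common place (not necessarily discrete): their ideal in `ℂ[s i]` is proper, hence dominated by
a valuation ring. -/
lemma exists_common_zero {ι : Type*} (s : ι → K)
    (hs : ∀ p : MvPolynomial ι ℂ, MvPolynomial.aeval s p = 0 → MvPolynomial.constantCoeff p = 0) :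
    ∃ B : ValuationSubring K, B.valuation.IsTrivialOn ℂ ∧ ∀ i, B.valuation (s i) < 1 := by
  let A := (MvPolynomial.aeval (R := ℂ) s).range
  let π : MvPolynomial ι ℂ →ₐ[ℂ] A := (MvPolynomial.aeval s).rangeRestrict
  have hπ : Function.Surjective π := (MvPolynomial.aeval s).rangeRestrict_surjective
  let I : Ideal A := Ideal.map π (RingHom.ker (MvPolynomial.constantCoeff (σ := ι) (R := ℂ)))
  have hI : I ≠ ⊤ := by
    rw [Ne, Ideal.eq_top_iff_one, Ideal.mem_map_iff_of_surjective _ hπ]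
    rintro ⟨p, hp, hp1⟩
    have h1 : MvPolynomial.aeval s p = 1 := congrArg Subtype.val hp1
    have h2 := hs (p - 1) (by rw [map_sub, h1, map_one, sub_self])
    rw [map_sub, map_one, (RingHom.mem_ker).mp hp] at h2
    simp at h2
  obtain ⟨B, hAB, hIB⟩ := Ideal.image_subset_nonunits_valuationSubring (A := A.toSubring) I hI
  have hle : ∀ c : ℂ, B.valuation (algebraMap ℂ K c) ≤ 1 := fun c =>
    (B.valuation_le_one_iff _).mpr (hAB (A.algebraMap_mem c))
  refine ⟨B, isTrivialOn_of_le_one hle, fun i => ?_⟩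
  · refine B.mem_nonunits_iff.mp (hIB ⟨π (MvPolynomial.X i), Ideal.mem_map_of_mem _ ?_, ?_⟩)
    · simp [RingHom.mem_ker]
    · exact MvPolynomial.aeval_X s i
end Existence

/-! ### The generic point of a component -/

open Polynomial in
lemma C_mul_denom_sub_ne_zero {G : RatFunc ℂ} (hG : 2 ≤ degree G) {α β : ℂ}
    (h : α ≠ 0 ∨ β ≠ 0) : C α * G.denom - C β * G.num ≠ 0 := by
  intro h0
  have h1 : C α * G.denom = C β * G.num := sub_eq_zero.mp h0
  by_cases hβ : β = 0
  · have hα : α ≠ 0 := h.resolve_right (not_not.mpr hβ)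
    simp [hβ, hα, G.denom_ne_zero] at h1
  · have h2 : G.num = C (β⁻¹ * α) * G.denom := by
      rw [C_mul, mul_assoc, h1, ← mul_assoc, ← C_mul, inv_mul_cancel₀ hβ, C_1, one_mul]
    obtain ⟨a, b, hab⟩ := G.isCoprime_num_denom
    have hu : IsUnit G.denom := isUnit_of_dvd_one ⟨a * C (β⁻¹ * α) + b, by
      rw [← hab, h2]; ring⟩
    have hd0 : G.denom.natDegree = 0 := natDegree_eq_zero_of_isUnit hu
    have hn0 : G.num.natDegree = 0 := by
      have := natDegree_C_mul_le (β⁻¹ * α) G.denom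
      rw [← h2] at this; omega
    simp [degree, hd0, hn0] at hG

namespace GraphComponent

open MvPolynomial

variable {G : RatFunc ℂ} {hG : 2 ≤ degree G} (V : GraphComponent G hG)

lemma aeval_coordFun (p : MvPolynomial (Fin 2) ℂ) :
    aeval V.coordFun p = algebraMap (MvPolynomial (Fin 2) ℂ ⧸ V.ideal) V.FunctionField
      (Ideal.Quotient.mk V.ideal p) := by
  have : aeval V.coordFun = (IsScalarTower.toAlgHom ℂ (MvPolynomial (Fin 2) ℂ ⧸ V.ideal)
      V.FunctionField).comp (Ideal.Quotient.mkₐ ℂ V.ideal) := by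
    ext i
    simp [coordFun]
  rw [this]
  rfl

lemma aeval_coordFun_eq_zero_iff (p : MvPolynomial (Fin 2) ℂ) :
    aeval V.coordFun p = 0 ↔ p ∈ V.ideal := by
  rw [aeval_coordFun, FaithfulSMul.algebraMap_eq_zero_iff, Ideal.Quotient.eq_zero_iff_mem]

lemma mem_ideal_iff (p : MvPolynomial (Fin 2) ℂ) :
    p ∈ V.ideal ↔ ∀ w : Fin 2 → ℂ, ((w 0 : P1), (w 1 : P1)) ∈ V.carrier → eval w p = 0 :=
  Iff.rfl

lemma aeval_coordFun_X_poly (i : Fin 2) (p : Polynomial ℂ) :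
    aeval V.coordFun (Polynomial.aeval (X i : MvPolynomial (Fin 2) ℂ) p)
      = Polynomial.aeval (V.coordFun i) p := by
  rw [← Polynomial.aeval_algHom_apply, aeval_X]

/-- The forms on `ℙ¹ × ℙ¹` at the generic point of `V`. -/
def genericEval (F : MvPolynomial (Fin 2 ⊕ Fin 2) ℂ) : V.FunctionField :=
  aeval (Sum.elim ![V.coordFun 0, 1] ![V.coordFun 1, 1]) F

/-- `V` lies in no coordinate line at infinity, so that forms are controlled by `V ∩ ℂ²`. -/
lemma exists_affine_of_form_ne_zero {F : MvPolynomial (Fin 2 ⊕ Fin 2) ℂ} {m : ℕ × ℕ}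
    (hF : F.IsWeightedHomogeneous bidegree m) {p : P1 × P1} (hp : p ∈ V.carrier)
    (hFp : formEval F p ≠ 0) :
    ∃ w : Fin 2 → ℂ, ((w 0 : P1), (w 1 : P1)) ∈ V.carrier ∧
      formEval F ((w 0 : P1), (w 1 : P1)) ≠ 0 := by
  let _ := zariski
  have hirr : IsIrreducible V.carrier := V.maximal.prop.2
  obtain ⟨w0, hw0⟩ := affinePart_nonempty V
  have hL := (isWeightedHomogeneous_X ℂ bidegree (Sum.inl 1)).mul
    (isWeightedHomogeneous_X ℂ bidegree (Sum.inr 1))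
  obtain ⟨⟨x, y⟩, hxy, h1, h2⟩ := hirr.2 _ _ (isOpen_form hL) (isOpen_form hF)
    ⟨_, hw0, by simp [formEval, coord, OnePoint.some]⟩ ⟨_, hp, hFp⟩
  rcases x with _ | x
  · exact absurd (by simp [formEval, coord]) h1
  rcases y with _ | y
  · exact absurd (by simp [formEval, coord]) h1
  exact ⟨![x, y], hxy, h2⟩

lemma genericEval_eq_zero_iff {F : MvPolynomial (Fin 2 ⊕ Fin 2) ℂ} {m : ℕ × ℕ}
    (hF : F.IsWeightedHomogeneous bidegree m) :
    V.genericEval F = 0 ↔ ∀ p ∈ V.carrier, formEval F p = 0 := by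
  have h1 : V.genericEval F = aeval V.coordFun
      (bind₁ (Sum.elim ![X 0, 1] ![X 1, 1] : Fin 2 ⊕ Fin 2 → MvPolynomial (Fin 2) ℂ) F) := by
    rw [aeval_bind₁, genericEval]
    congr 2
    funext i
    rcases i with i | i <;> fin_cases i <;> simp
  have h2 : ∀ w : Fin 2 → ℂ, eval w
      (bind₁ (Sum.elim ![X 0, 1] ![X 1, 1] : Fin 2 ⊕ Fin 2 → MvPolynomial (Fin 2) ℂ) F)
        = formEval F ((w 0 : P1), (w 1 : P1)) := by
    intro w
    rw [eval, eval₂Hom_bind₁, formEval, eval]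
    congr 2
    funext i
    rcases i with i | i <;> fin_cases i <;> simp [coord]
  rw [h1, aeval_coordFun_eq_zero_iff, mem_ideal_iff]
  simp only [h2]
  refine ⟨fun h p hp => ?_, fun h w hw => h _ hw⟩
  by_contra hne
  obtain ⟨w, hw, hw'⟩ := V.exists_affine_of_form_ne_zero hF hp hne
  exact hw' (h w hw)

lemma graph_relation :
    Polynomial.aeval (V.coordFun 0) G.num * Polynomial.aeval (V.coordFun 1) G.denom
    = Polynomial.aeval (V.coordFun 1) G.num * Polynomial.aeval (V.coordFun 0) G.denom := by
  have hev : ∀ (f : Polynomial ℂ) (i : Fin 2) (w : Fin 2 → ℂ), eval w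
      (Polynomial.aeval (X i : MvPolynomial (Fin 2) ℂ) f) = f.eval (w i) := by
    intro f i w
    rw [← coe_aeval_eq_eval, RingHom.coe_coe, ← Polynomial.aeval_algHom_apply,
      aeval_X, Polynomial.coe_aeval_eq_eval]
  rw [← sub_eq_zero]
  simp only [← aeval_coordFun_X_poly]
  rw [← map_mul, ← map_mul, ← map_sub, aeval_coordFun_eq_zero_iff, mem_ideal_iff]
  intro w hw
  simp only [map_sub, map_mul, hev]
  have h : toMap G (w 0 : P1) = toMap G (w 1 : P1) := V.maximal.prop.1 hw
  change (if _ then _ else _) = (if _ then _ else _) at h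
  split_ifs at h with h1 h2 h2
  · rw [h1, h2]; simp
  · exact absurd h (OnePoint.infty_ne_coe _)
  · exact absurd h (OnePoint.coe_ne_infty _)
  · have := OnePoint.coe_injective h
    rw [div_eq_div_iff h1 h2] at this
    rw [this, sub_self]

lemma not_both_const {a b : ℂ} (ha : V.coordFun 0 = algebraMap ℂ _ a)
    (hb : V.coordFun 1 = algebraMap ℂ _ b) : False := by
  let _ := zariski
  have hmem : ∀ (i : Fin 2) (c : ℂ), V.coordFun i = algebraMap ℂ _ c →
      ∀ w : Fin 2 → ℂ, ((w 0 : P1), (w 1 : P1)) ∈ V.carrier → w i = c := by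
    intro i c hc w hw
    have h : X i - C c ∈ V.ideal := by
      rw [← aeval_coordFun_eq_zero_iff, map_sub, aeval_X, hc, aeval_C, sub_self]
    have := (V.mem_ideal_iff _).mp h w hw
    simpa [sub_eq_zero] using this
  have hcl : ∀ (i : Fin 2) (c : ℂ), V.coordFun i = algebraMap ℂ _ c →
      ∀ p ∈ V.carrier, (if i = 0 then p.1 else p.2) = (c : P1) := by
    intro i c hc p hp
    by_contra hne
    obtain ⟨F, m, hF, hFp, hFU⟩ := exists_form_of_isOpen (isClosed_coord i (c : P1)).isOpen_compl
      p hne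
    obtain ⟨w, hw, hFw⟩ := V.exists_affine_of_form_ne_zero hF hp hFp
    refine hFU _ hFw ?_
    have := hmem i c hc w hw
    fin_cases i <;> exact congrArg (fun z : ℂ => (z : P1)) this
  obtain ⟨q, hq⟩ := V.maximal.prop.2.nonempty
  have hall : ∀ p ∈ V.carrier, p = ((a : P1), (b : P1)) := fun p hp =>
    Prod.ext (hcl 0 a ha p hp) (hcl 1 b hb p hp)
  refine not_singleton V ((a : P1), (b : P1)) (Set.eq_singleton_iff_unique_mem.mpr ⟨?_, hall⟩)
  rwa [← hall q hq]

/-- If `x` is constant on `V`, so is `y`, and conversely. -/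
lemma const_of_const {i j : Fin 2} {a : ℂ} (h : V.coordFun i = algebraMap ℂ _ a)
    (hij : Polynomial.aeval (V.coordFun i) G.num * Polynomial.aeval (V.coordFun j) G.denom
      = Polynomial.aeval (V.coordFun j) G.num * Polynomial.aeval (V.coordFun i) G.denom) :
    ∃ b : ℂ, V.coordFun j = algebraMap ℂ _ b := by
  refine exists_const_of_not_transcendental fun hj => ?_
  have hab : G.num.eval a ≠ 0 ∨ G.denom.eval a ≠ 0 := by
    by_contra! h0
    exact not_both_zero G a h0.2 h0.1
  refine C_mul_denom_sub_ne_zero hG hab ((transcendental_iff.mp hj) _ ?_)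
  rw [h, Polynomial.aeval_algebraMap_apply_eq_algebraMap_eval,
    Polynomial.aeval_algebraMap_apply_eq_algebraMap_eval] at hij
  rw [map_sub, map_mul, map_mul, Polynomial.aeval_C, Polynomial.aeval_C, hij]
  ring

lemma transcendental_coordFun (i : Fin 2) : Transcendental ℂ (V.coordFun i) := by
  by_contra hi
  obtain ⟨a, ha⟩ := exists_const_of_not_transcendental hi
  fin_cases i
  · obtain ⟨b, hb⟩ := V.const_of_const ha V.graph_relation
    exact V.not_both_const ha hb
  · obtain ⟨b, hb⟩ := V.const_of_const ha V.graph_relation.symm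
    exact V.not_both_const hb ha

/-- The function field is algebraic over `ℂ(x)`. -/
lemma trdeg_functionField_le : Algebra.trdeg ℂ V.FunctionField ≤ 1 := by
  let A := Algebra.adjoin ℂ {V.coordFun 0}
  let x : A := ⟨V.coordFun 0, Algebra.self_mem_adjoin_singleton ℂ _⟩
  have hx : ∀ p : Polynomial ℂ, ((Polynomial.aeval x p : A) : V.FunctionField)
      = Polynomial.aeval (V.coordFun 0) p := fun p =>
    (Polynomial.aeval_algHom_apply A.val x p).symm
  have hx' : algebraMap A V.FunctionField x = V.coordFun 0 := rfl
  have hy : IsAlgebraic A (V.coordFun 1) := by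
    refine ⟨G.denom.map (algebraMap ℂ A) * Polynomial.C (Polynomial.aeval x G.num)
      - G.num.map (algebraMap ℂ A) * Polynomial.C (Polynomial.aeval x G.denom), fun h => ?_, ?_⟩
    · have hcoeff : ∀ i, Polynomial.C (G.denom.coeff i) * G.num
          - Polynomial.C (G.num.coeff i) * G.denom = 0 := by
        intro i
        refine (transcendental_iff.mp (V.transcendental_coordFun 0)) _ ?_
        have h1 := congrArg (fun q : Polynomial A => ((q.coeff i : A) : V.FunctionField)) h
        simpa [hx, Algebra.smul_def] using h1
      have hd : G.denom.coeff G.denom.natDegree ≠ 0 :=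
        Polynomial.leadingCoeff_ne_zero.mpr G.denom_ne_zero
      have h2 := C_mul_denom_sub_ne_zero hG (Or.inr hd)
        (α := G.num.coeff G.denom.natDegree)
      exact h2 (by rw [← neg_eq_zero, neg_sub]; exact hcoeff _)
    · have := V.graph_relation
      simp only [map_sub, map_mul, Polynomial.aeval_C, Polynomial.aeval_map_algebraMap]
      change _ * ((Polynomial.aeval x G.num : A) : V.FunctionField) -
        _ * ((Polynomial.aeval x G.denom : A) : V.FunctionField) = 0
      rw [hx, hx]
      linear_combination this
  have hpoly : ∀ p : MvPolynomial (Fin 2) ℂ, IsAlgebraic A (aeval V.coordFun p) := by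
    intro p
    induction p using MvPolynomial.induction_on with
    | C c =>
      rw [aeval_C, IsScalarTower.algebraMap_apply ℂ A]
      exact isAlgebraic_algebraMap _
    | add p q hp hq => rw [map_add]; exact hp.add hq
    | mul_X p i hp =>
      rw [map_mul, aeval_X]
      refine hp.mul ?_
      fin_cases i
      · exact isAlgebraic_algebraMap x
      · exact hy
  have : Algebra.IsAlgebraic A V.FunctionField := by
    refine ⟨fun f => ?_⟩
    obtain ⟨p, q, -, rfl⟩ := IsFractionRing.div_surjective (A := MvPolynomial (Fin 2) ℂ ⧸ V.ideal) f
    obtain ⟨p, rfl⟩ := Ideal.Quotient.mk_surjective p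
    obtain ⟨q, rfl⟩ := Ideal.Quotient.mk_surjective q
    rw [← aeval_coordFun, ← aeval_coordFun, div_eq_mul_inv]
    exact (hpoly p).mul (hpoly q).inv
  simpa using Algebra.IsAlgebraic.trdeg_le_cardinalMk (R := ℂ) (s := {V.coordFun 0})

instance : Algebra.EssFiniteType ℂ V.FunctionField :=
  have : Algebra.EssFiniteType (MvPolynomial (Fin 2) ℂ ⧸ V.ideal) V.FunctionField :=
    .of_isLocalization _ (nonZeroDivisors _)
  .comp ℂ (MvPolynomial (Fin 2) ℂ ⧸ V.ideal) V.FunctionField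

end GraphComponent

/-! ### Places of the function field and points of the component -/

lemma exists_algHom_of_transcendental {K : Type*} [Field K] [Algebra ℂ K] {t : K}
    (ht : Transcendental ℂ t) : ∃ φ : RatFunc ℂ →ₐ[ℂ] K, φ RatFunc.X = t :=
  ⟨(IntermediateField.val _).comp (RatFunc.algEquivOfTranscendental t ht).toAlgHom, by simp⟩

open MvPolynomial

/-- Homogenization in arbitrary linear charts `s = ℓ / m` and `t = ℓ' / m'` of the two factors. -/
lemma exists_homogenization_chart {ℓ m ℓ' m' : MvPolynomial (Fin 2 ⊕ Fin 2) ℂ}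
    (hl : ℓ.IsWeightedHomogeneous bidegree (1, 0)) (hm : m.IsWeightedHomogeneous bidegree (1, 0))
    (hl' : ℓ'.IsWeightedHomogeneous bidegree (0, 1))
    (hm' : m'.IsWeightedHomogeneous bidegree (0, 1)) (h : MvPolynomial (Fin 2) ℂ) :
    ∃ (n : ℕ) (F : MvPolynomial (Fin 2 ⊕ Fin 2) ℂ), F.IsWeightedHomogeneous bidegree (n, n) ∧
      ∀ (L : Type) [Field L] [Algebra ℂ L] (c : Fin 2 ⊕ Fin 2 → L), aeval c m ≠ 0 →
        aeval c m' ≠ 0 → aeval c F = aeval c m ^ n * aeval c m' ^ n *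
          aeval ![aeval c ℓ / aeval c m, aeval c ℓ' / aeval c m'] h := by
  suffices H : ∃ N : ℕ, ∀ n, N ≤ n → ∃ F : MvPolynomial (Fin 2 ⊕ Fin 2) ℂ,
      F.IsWeightedHomogeneous bidegree (n, n) ∧
      ∀ (L : Type) [Field L] [Algebra ℂ L] (c : Fin 2 ⊕ Fin 2 → L), aeval c m ≠ 0 →
        aeval c m' ≠ 0 → aeval c F = aeval c m ^ n * aeval c m' ^ n *
          aeval ![aeval c ℓ / aeval c m, aeval c ℓ' / aeval c m'] h by
    obtain ⟨N, hN⟩ := H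
    exact ⟨N, hN N le_rfl⟩
  induction h using MvPolynomial.induction_on with
  | C a =>
    refine ⟨0, fun n _ => ⟨C a * (m ^ n * m' ^ n), ?_, fun L _ _ c _ _ => ?_⟩⟩
    · simpa using ((hm.pow n).mul (hm'.pow n)).C_mul a
    · simp only [map_mul, map_pow, aeval_C]
      ring
  | add p q hp hq =>
    obtain ⟨N, hN⟩ := hp
    obtain ⟨M, hM⟩ := hq
    refine ⟨max N M, fun n hn => ?_⟩
    obtain ⟨F, hF, hF'⟩ := hN n (le_trans (le_max_left _ _) hn)
    obtain ⟨H, hH, hH'⟩ := hM n (le_trans (le_max_right _ _) hn)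
    refine ⟨F + H, hF.add hH, fun L _ _ c h1 h2 => ?_⟩
    rw [map_add, map_add, hF' L c h1 h2, hH' L c h1 h2, mul_add]
  | mul_X p i hp =>
    obtain ⟨N, hN⟩ := hp
    refine ⟨N + 1, fun n hn => ?_⟩
    obtain ⟨n, rfl⟩ : ∃ k, n = k + 1 := ⟨n - 1, by omega⟩
    obtain ⟨F, hF, hF'⟩ := hN n (by omega)
    fin_cases i
    · refine ⟨F * (ℓ * m'), by simpa using hF.mul (hl.mul hm'), fun L _ _ c h1 h2 => ?_⟩
      rw [map_mul, hF' L c h1 h2, map_mul, map_mul, aeval_X]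
      simp only [Fin.zero_eta, Matrix.cons_val_zero]
      field_simp
      ring
    · refine ⟨F * (m * ℓ'), by simpa using hF.mul (hm.mul hl'), fun L _ _ c h1 h2 => ?_⟩
      rw [map_mul, hF' L c h1 h2, map_mul, map_mul, aeval_X]
      simp only [Fin.mk_one, Matrix.cons_val_one, Matrix.cons_val_zero]
      field_simp
      ring

lemma aeval_scale {L : Type*} [Field L] [Algebra ℂ L] {F : MvPolynomial (Fin 2 ⊕ Fin 2) ℂ}
    {m : ℕ × ℕ} (hF : F.IsWeightedHomogeneous bidegree m) (s t : L) (c d : Fin 2 → L) :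
    aeval (Sum.elim (s • c) (t • d)) F = s ^ m.1 * t ^ m.2 * aeval (Sum.elim c d) F := by
  induction hF using MvPolynomial.IsWeightedHomogeneous.induction_on with
  | zero => simp
  | add p q _ _ hp hq => rw [map_add, hp, hq, map_add]; ring
  | monomial e r he =>
    subst he
    rw [Finsupp.weight_apply, Finsupp.sum_fintype _ _ (by simp)]
    simp [aeval_monomial, Finsupp.prod_fintype, Fintype.prod_sum_type,
      Fin.prod_univ_two, bidegree, mul_pow, pow_add]
    ring

/-- Linear forms `ℓ`, `m` in the variables `u`, whose quotient is a parameter at `a ∈ ℙ¹`. -/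
def chartForm {σ : Type*} (u : Fin 2 → σ) : P1 → MvPolynomial σ ℂ × MvPolynomial σ ℂ
  | none => (X (u 1), X (u 0))
  | some a => (X (u 0) - C a * X (u 1), X (u 1))

namespace GraphComponent

variable {G : RatFunc ℂ} {hG : 2 ≤ degree G} (V : GraphComponent G hG)

lemma coordFun_ne_zero (i : Fin 2) : V.coordFun i ≠ 0 := fun h =>
  V.transcendental_coordFun i (h ▸ isAlgebraic_zero)

lemma localParam_lt_one_iff {Γ : Type*} [LinearOrderedCommGroupWithZero Γ]
    {v : Valuation V.FunctionField Γ} {f : V.FunctionField} (hf : f ≠ 0) {a : P1} :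
    v (V.localParam f a) < 1 ↔ HasValue v f a := by
  rcases a with _ | a
  · change v f⁻¹ < 1 ↔ 1 < v f
    rw [map_inv₀, inv_lt_one₀ (zero_lt_iff.mpr ((Valuation.ne_zero_iff v).mpr hf))]
  · rfl

/-- Every point in the Zariski closure of `V` is the centre of a place of `ℂ(V)`. -/
lemma exists_place {p : P1 × P1}
    (hp : ∀ F m, IsWeightedHomogeneous bidegree F m → (∀ q ∈ V.carrier, formEval F q = 0) →
      formEval F p = 0) :
    ∃ B : ValuationSubring V.FunctionField, B.valuation.IsTrivialOn ℂ ∧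
      HasValue B.valuation (V.coordFun 0) p.1 ∧ HasValue B.valuation (V.coordFun 1) p.2 := by
  obtain ⟨a, b⟩ := p
  have hX := fun j => isWeightedHomogeneous_X ℂ bidegree j
  have hform : ∀ (a : P1) (u : Fin 2 → Fin 2 ⊕ Fin 2), bidegree (u 0) = bidegree (u 1) →
      (chartForm u a).1.IsWeightedHomogeneous bidegree (bidegree (u 0)) ∧
      (chartForm u a).2.IsWeightedHomogeneous bidegree (bidegree (u 0)) := by
    rintro (_ | a) u hu
    · exact ⟨by rw [hu]; exact hX _, hX _⟩
    · refine ⟨(hX _).sub ?_, by rw [hu]; exact hX _⟩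
      rw [hu]
      exact (hX _).C_mul a
  have hgen : ∀ (a : P1) (u : Fin 2 → Fin 2 ⊕ Fin 2) (c : Fin 2 ⊕ Fin 2 → V.FunctionField)
      (f : V.FunctionField), f ≠ 0 → c (u 0) = f → c (u 1) = 1 → aeval c (chartForm u a).2 ≠ 0 ∧
        aeval c (chartForm u a).1 / aeval c (chartForm u a).2 = V.localParam f a := by
    rintro (_ | a) u c f hf h0 h1
    · simp [chartForm, localParam, h0, h1, hf]
    · simp [chartForm, localParam, h0, h1]
  have hpt : ∀ (a : P1) (u : Fin 2 → Fin 2 ⊕ Fin 2) (c : Fin 2 ⊕ Fin 2 → ℂ),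
      (∀ i, c (u i) = coord a i) → aeval c (chartForm u a).2 = 1 ∧
        aeval c (chartForm u a).1 = 0 := by
    rintro (_ | a) u c h
    · simp [chartForm, h, coord]
    · simp [chartForm, h, coord]
  obtain ⟨B, hB, hs⟩ := exists_common_zero
      ![V.localParam (V.coordFun 0) a, V.localParam (V.coordFun 1) b] (by
    intro h hh
    obtain ⟨n, F, hF, hFev⟩ := exists_homogenization_chart (hform a Sum.inl rfl).1
      (hform a Sum.inl rfl).2 (hform b Sum.inr rfl).1 (hform b Sum.inr rfl).2 h
    have h0 : V.genericEval F = 0 := by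
      obtain ⟨h1, h2⟩ := hgen a Sum.inl (Sum.elim ![V.coordFun 0, 1] ![V.coordFun 1, 1]) _
        (V.coordFun_ne_zero 0) rfl rfl
      obtain ⟨h3, h4⟩ := hgen b Sum.inr (Sum.elim ![V.coordFun 0, 1] ![V.coordFun 1, 1]) _
        (V.coordFun_ne_zero 1) rfl rfl
      rw [genericEval, hFev _ _ h1 h3, h2, h4, hh, mul_zero]
    have h1 := hp F _ hF ((V.genericEval_eq_zero_iff hF).mp h0)
    obtain ⟨h2, h3⟩ := hpt a Sum.inl (Sum.elim (coord a) (coord b)) (fun _ => rfl)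
    obtain ⟨h4, h5⟩ := hpt b Sum.inr (Sum.elim (coord a) (coord b)) (fun _ => rfl)
    have h6 := hFev ℂ (Sum.elim (coord a) (coord b)) (by rw [h2]; exact one_ne_zero)
      (by rw [h4]; exact one_ne_zero)
    rw [h2, h3, h4, h5, aeval_eq_eval, aeval_eq_eval] at h6
    rw [formEval, h6] at h1
    have h7 : (![0 / 1, 0 / 1] : Fin 2 → ℂ) = 0 := by
      ext i; fin_cases i <;> simp
    rw [h7, one_pow, one_mul, one_mul] at h1
    exact (eval₂Hom_zero_apply (RingHom.id ℂ) h).symm.trans h1)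
  exact ⟨B, hB, (V.localParam_lt_one_iff (V.coordFun_ne_zero 0)).mp (hs 0),
    (V.localParam_lt_one_iff (V.coordFun_ne_zero 1)).mp (hs 1)⟩

/-- The equation `G(x) = G(y)` of `V_G` specializes to every place. -/
lemma toMap_eq_of_hasValue {Γ : Type*} [LinearOrderedCommGroupWithZero Γ]
    {v : Valuation V.FunctionField Γ} [v.IsTrivialOn ℂ] {a b : P1}
    (ha : HasValue v (V.coordFun 0) a) (hb : HasValue v (V.coordFun 1) b) :
    toMap G a = toMap G b := by
  obtain ⟨φ, hφ⟩ := exists_algHom_of_transcendental (V.transcendental_coordFun 0)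
  obtain ⟨ψ, hψ⟩ := exists_algHom_of_transcendental (V.transcendental_coordFun 1)
  have hG' : φ G = ψ G := by
    rw [map_eq_aeval_div φ, map_eq_aeval_div ψ, hφ, hψ, div_eq_div_iff, V.graph_relation]
    · exact fun h => transcendental_iff.mp (V.transcendental_coordFun 0) _ h |> G.denom_ne_zero
    · exact fun h => transcendental_iff.mp (V.transcendental_coordFun 1) _ h |> G.denom_ne_zero
  have h1 := HasValue.map (φ := φ) (hφ ▸ ha) G
  have h2 := HasValue.map (φ := ψ) (hψ ▸ hb) G
  rw [hG'] at h1
  exact h1.unique h2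

/-- A component is Zariski closed, by maximality: its closure is irreducible, and contained in
`V_G` since each of its points is the centre of a place. -/
lemma mem_carrier_of_forms {p : P1 × P1}
    (hp : ∀ F m, IsWeightedHomogeneous bidegree F m → (∀ q ∈ V.carrier, formEval F q = 0) →
      formEval F p = 0) : p ∈ V.carrier := by
  let S : Set (P1 × P1) := {p | ∀ F m, IsWeightedHomogeneous bidegree F m →
    (∀ q ∈ V.carrier, formEval F q = 0) → formEval F p = 0}
  have hVS : V.carrier ⊆ S := fun q hq F m _ h => h q hq
  have hSG : S ⊆ graph G := by
    intro q hq
    obtain ⟨B, hB, h1, h2⟩ := V.exists_place hq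
    exact V.toMap_eq_of_hasValue h1 h2
  have hmeet : ∀ U, IsOpen[zariski] U → (S ∩ U).Nonempty → (V.carrier ∩ U).Nonempty := by
    rintro U hU ⟨q, hqS, hqU⟩
    obtain ⟨F, m, hF, hFq, hFU⟩ := exists_form_of_isOpen hU q hqU
    by_contra hemp
    refine hFq (hqS F m hF fun r hr => ?_)
    by_contra hne
    exact hemp ⟨r, hr, hFU r hne⟩
  have hirr : @IsIrreducible _ zariski V.carrier := V.maximal.prop.2
  have hS : @IsIrreducible _ zariski S :=
    ⟨hirr.1.mono hVS, fun U U' hU hU' h h' =>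
      (hirr.2 U U' hU hU' (hmeet U hU h) (hmeet U' hU' h')).mono
        (Set.inter_subset_inter_left _ hVS)⟩
  exact V.maximal.le_of_ge ⟨hSG, hS⟩ hVS hp

lemma exists_place_of_mem {p : P1 × P1} (hp : p ∈ V.carrier) :
    ∃ B : ValuationSubring V.FunctionField, B.valuation.IsTrivialOn ℂ ∧
      HasValue B.valuation (V.coordFun 0) p.1 ∧ HasValue B.valuation (V.coordFun 1) p.2 :=
  V.exists_place fun _ _ _ h => h p hp

/-- The centre of a place lies on `V`. -/
lemma mem_carrier_of_hasValue {Γ : Type*} [LinearOrderedCommGroupWithZero Γ]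
    {v : Valuation V.FunctionField Γ} [v.IsTrivialOn ℂ] {p : P1 × P1}
    (ha : HasValue v (V.coordFun 0) p.1) (hb : HasValue v (V.coordFun 1) p.2) :
    p ∈ V.carrier := by
  obtain ⟨a, b⟩ := p
  -- homogeneous coordinates of the generic point that are regular, and not both zero, at `v`
  have hvec : ∀ (f : V.FunctionField) (a : P1), f ≠ 0 → HasValue v f a →
      ∃ (s : V.FunctionField), ∀ i, HasValue v ((s • ![f, 1]) i) (coord a i : P1) := by
    rintro f (_ | a) hf h
    · refine ⟨f⁻¹, fun i => ?_⟩
      fin_cases i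
      · simp [hasValue_coe, coord, hf]
      · simpa [hasValue_coe, coord] using
          inv_lt_one_of_one_lt₀ (hasValue_infty.mp h)
    · refine ⟨1, fun i => ?_⟩
      fin_cases i
      · simpa [hasValue_coe, coord] using hasValue_coe.mp h
      · simp [hasValue_coe, coord]
  obtain ⟨s, hs⟩ := hvec _ a (V.coordFun_ne_zero 0) ha
  obtain ⟨t, ht⟩ := hvec _ b (V.coordFun_ne_zero 1) hb
  refine V.mem_carrier_of_forms fun F m hF h => ?_
  have h0 : V.genericEval F = 0 := (V.genericEval_eq_zero_iff hF).mpr h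
  have h1 := hasValue_mvPolynomial_aeval (v := v) (f := Sum.elim (s • ![V.coordFun 0, 1])
    (t • ![V.coordFun 1, 1])) (a := Sum.elim (coord a) (coord b))
    (by rintro (i | i); exacts [hs i, ht i]) F
  rw [aeval_scale hF, ← genericEval, h0, mul_zero] at h1
  have h2 : HasValue v (0 : V.FunctionField) ((0 : ℂ) : P1) := by simp [hasValue_coe]
  exact OnePoint.coe_injective (h1.unique h2)

end GraphComponent

/-! ### Riemann–Roch spaces -/

lemma exists_val_lt_one_of_surjective {K : Type*} [Field K] {v : Valuation K ℤᵐ⁰}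
    (hv : Function.Surjective v) : ∃ s, s ≠ 0 ∧ v s < 1 := by
  obtain ⟨s, hs⟩ := hv (WithZero.exp (-1))
  refine ⟨s, fun h => ?_, ?_⟩
  · rw [h, map_zero] at hs
    exact WithZero.exp_ne_zero hs.symm
  · rw [hs, ← WithZero.exp_zero, WithZero.exp_lt_exp]
    norm_num

lemma le_exp_of_lt_exp_add_one {x : ℤᵐ⁰} {n : ℤ} (h : x < WithZero.exp (n + 1)) :
    x ≤ WithZero.exp n := by
  rw [WithZero.exp_add] at h
  exact (WithZero.lt_mul_exp_iff_le WithZero.exp_ne_zero).mp h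

namespace GraphComponent

variable {G : RatFunc ℂ} {hG : 2 ≤ degree G} (V : GraphComponent G hG)

lemma exists_hasValue_functionField {Γ : Type*} [LinearOrderedCommGroupWithZero Γ]
    {v : Valuation V.FunctionField Γ} [v.IsTrivialOn ℂ] (hnt : ∃ s, s ≠ 0 ∧ v s < 1)
    (f : V.FunctionField) : ∃ a, HasValue v f a := by
  by_cases hf : Transcendental ℂ f
  · exact exists_hasValue (isAlgebraic_adjoin_of_trdeg_le V.trdeg_functionField_le hf) hnt
  · obtain ⟨c, rfl⟩ := exists_const_of_not_transcendental hf
    exact ⟨(c : P1), by simp [hasValue_coe]⟩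

instance (P : V.NormalizationPoint) : P.val.IsTrivialOn ℂ := P.trivialOn

variable {V} in
lemma NormalizationPoint.exists_hasValue (P : V.NormalizationPoint) (f : V.FunctionField) :
    ∃ a, HasValue P.val f a :=
  V.exists_hasValue_functionField (exists_val_lt_one_of_surjective P.surjective) f

/-- Every discrete place of `ℂ(V)` is a point of the normalization. -/
lemma exists_normalizationPoint {v : Valuation V.FunctionField ℤᵐ⁰} (hs : Function.Surjective v)
    (hv : v.IsTrivialOn ℂ) : ∃ P : V.NormalizationPoint, P.val = v := by
  obtain ⟨a, ha⟩ := V.exists_hasValue_functionField (exists_val_lt_one_of_surjective hs)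
    (V.coordFun 0)
  obtain ⟨b, hb⟩ := V.exists_hasValue_functionField (exists_val_lt_one_of_surjective hs)
    (V.coordFun 1)
  exact ⟨⟨(a, b), V.mem_carrier_of_hasValue ha hb, v, hs, hv,
    (V.localParam_lt_one_iff (V.coordFun_ne_zero 0)).mpr ha,
    (V.localParam_lt_one_iff (V.coordFun_ne_zero 1)).mpr hb⟩, rfl⟩

variable {V} in
lemma NormalizationPoint.ext_val {P Q : V.NormalizationPoint} (h : P.val = Q.val) : P = Q := by
  have key : ∀ (R : V.NormalizationPoint), HasValue R.val (V.coordFun 0) R.image.1 ∧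
      HasValue R.val (V.coordFun 1) R.image.2 := fun R =>
    ⟨(V.localParam_lt_one_iff (V.coordFun_ne_zero 0)).mp R.fst_lt_one,
      (V.localParam_lt_one_iff (V.coordFun_ne_zero 1)).mp R.snd_lt_one⟩
  have h1 : P.image.1 = Q.image.1 := (h ▸ (key P).1).unique (key Q).1
  have h2 : P.image.2 = Q.image.2 := (h ▸ (key P).2).unique (key Q).2
  have h3 : P.image = Q.image := Prod.ext h1 h2
  obtain ⟨pi, _, pv, _, _, _, _⟩ := P
  obtain ⟨qi, _, qv, _, _, _, _⟩ := Q
  simp only at h h3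
  subst h h3
  rfl

lemma exists_pole {f : V.FunctionField} (hf : Transcendental ℂ f) :
    ∃ P : V.NormalizationPoint, 1 < P.val f := by
  obtain ⟨v, h1, h2, h3⟩ := exists_discrete_place_pole V.trdeg_functionField_le hf
  obtain ⟨P, rfl⟩ := V.exists_normalizationPoint h1 h2
  exact ⟨P, h3⟩

lemma riemannRochSpace_mono {D E : V.NormalizationDivisor} (h : ∀ P, D P ≤ E P) :
    V.riemannRochSpace D ≤ V.riemannRochSpace E := fun _ hf P =>
  (hf P).trans (WithZero.exp_le_exp.mpr (h P))

lemma riemannRochSpace_zero_le : V.riemannRochSpace 0 ≤ Submodule.span ℂ {1} := by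
  intro f hf
  obtain ⟨c, rfl⟩ : ∃ c : ℂ, f = algebraMap ℂ _ c := by
    refine exists_const_of_not_transcendental fun ht => ?_
    obtain ⟨P, hP⟩ := V.exists_pole ht
    exact absurd (hf P) (not_le.mpr (by simpa using hP))
  rw [Algebra.algebraMap_eq_smul_one]
  exact Submodule.smul_mem _ _ (Submodule.mem_span_singleton_self 1)

variable {V} in
/-- The leading coefficients at a discrete place are constants. -/
lemma NormalizationPoint.exists_sub_lt (P : V.NormalizationPoint) {f g : V.FunctionField}
    (hg : g ≠ 0) (h : P.val f ≤ P.val g) :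
    ∃ c : ℂ, P.val (f - algebraMap ℂ _ c * g) < P.val g := by
  have hg0 : 0 < P.val g := zero_lt_iff.mpr ((Valuation.ne_zero_iff _).mpr hg)
  obtain ⟨a, ha⟩ := P.exists_hasValue (f / g)
  induction a using OnePoint.rec with
  | infty =>
    rw [hasValue_infty, map_div₀, one_lt_div₀ hg0] at ha
    exact absurd h (not_le.mpr ha)
  | coe c =>
    refine ⟨c, ?_⟩
    rwa [hasValue_coe, div_sub' hg, map_div₀, div_lt_one₀ hg0, mul_comm] at ha

lemma finiteDimensional_add_single (D : V.NormalizationDivisor) (P : V.NormalizationPoint)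
    (hD : FiniteDimensional ℂ (V.riemannRochSpace D)) :
    FiniteDimensional ℂ (V.riemannRochSpace (D + Finsupp.single P 1)) := by
  by_cases hle : V.riemannRochSpace (D + Finsupp.single P 1) ≤ V.riemannRochSpace D
  · exact Submodule.finiteDimensional_of_le hle
  obtain ⟨g, hg, hgD⟩ := SetLike.not_le_iff_exists.mp hle
  have hadd : ∀ Q : V.NormalizationPoint, Q ≠ P →
      (D + Finsupp.single P 1 : V.NormalizationDivisor) Q = D Q := by
    intro Q hQ
    simp [hQ.symm]
  have haddP : (D + Finsupp.single P 1 : V.NormalizationDivisor) P = D P + 1 := by simp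
  have hmem : ∀ f ∈ V.riemannRochSpace (D + Finsupp.single P 1),
      P.val f ≤ WithZero.exp (D P) → f ∈ V.riemannRochSpace D := by
    intro f hf hfP Q
    by_cases hQ : Q = P
    · rw [hQ]; exact hfP
    · rw [← hadd Q hQ]; exact hf Q
  have hgP : P.val g = WithZero.exp (D P + 1) := by
    refine le_antisymm (haddP ▸ hg P) (not_lt.mp fun hlt => ?_)
    exact hgD (hmem g hg (le_exp_of_lt_exp_add_one hlt))
  have hg0 : g ≠ 0 := fun h => hgD (h ▸ Submodule.zero_mem _)
  have hsup : V.riemannRochSpace (D + Finsupp.single P 1)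
      ≤ V.riemannRochSpace D ⊔ Submodule.span ℂ {g} := by
    intro f hf
    obtain ⟨c, hc⟩ := P.exists_sub_lt (f := f) hg0 (by
      rw [hgP, ← haddP]; exact hf P)
    rw [hgP, ← Algebra.smul_def] at hc
    rw [← sub_add_cancel f (c • g)]
    exact Submodule.add_mem_sup
      (hmem _ (Submodule.sub_mem _ hf (Submodule.smul_mem _ _ hg)) (le_exp_of_lt_exp_add_one hc))
      (Submodule.smul_mem _ _ (Submodule.mem_span_singleton_self g))
  exact Submodule.finiteDimensional_of_le hsup

instance finiteDimensional_riemannRochSpace (D : V.NormalizationDivisor) :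
    FiniteDimensional ℂ (V.riemannRochSpace D) := by
  induction D using Finsupp.induction with
  | zero => exact Submodule.finiteDimensional_of_le V.riemannRochSpace_zero_le
  | single_add P n D _ _ ih =>
    have hnat : ∀ n : ℕ, FiniteDimensional ℂ
        (V.riemannRochSpace (D + Finsupp.single P (n : ℤ))) := by
      intro n
      induction n with
      | zero => rwa [Nat.cast_zero, Finsupp.single_zero, add_zero]
      | succ n hn =>
        have := V.finiteDimensional_add_single _ P hn
        rwa [add_assoc, ← Finsupp.single_add] at this
    have := hnat n.toNat
    refine Submodule.finiteDimensional_of_le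
      (V.riemannRochSpace_mono (E := D + Finsupp.single P (n.toNat : ℤ)) fun Q => ?_)
    by_cases hQ : P = Q
    · subst hQ
      simp [add_comm]
    · simp [hQ]

/-! ### Curves of genus zero are rational -/

lemma genus_eq_zero_iff : V.genus = 0 ↔ ∀ D : V.NormalizationDivisor,
    V.divisorDegree D + 1 ≤ Module.finrank ℂ (V.riemannRochSpace D) := by
  rw [genus, ENat.iSup_eq_zero]
  refine forall_congr' fun D => ?_
  rw [Nat.cast_eq_zero, Int.toNat_eq_zero]
  omega

variable {V} in
/-- If `t` has a simple pole at `P`, the functions with poles only at `P` are polynomials in `t`. -/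
lemma NormalizationPoint.mem_range_aeval {P : V.NormalizationPoint} {t : V.FunctionField}
    (ht : P.val t = WithZero.exp 1) (ht' : ∀ Q, Q ≠ P → Q.val t ≤ 1) (n : ℕ) :
    ∀ f : V.FunctionField, P.val f ≤ WithZero.exp (n : ℤ) → (∀ Q, Q ≠ P → Q.val f ≤ 1) →
      f ∈ (Polynomial.aeval (R := ℂ) t).range := by
  have ht0 : t ≠ 0 := by
    rintro rfl
    rw [map_zero] at ht
    exact WithZero.exp_ne_zero ht.symm
  induction n with
  | zero =>
    intro f hfP hf
    have h0 : f ∈ V.riemannRochSpace 0 := by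
      intro Q
      by_cases hQ : Q = P
      · rw [hQ]; exact hfP
      · exact hf Q hQ
    obtain ⟨c, rfl⟩ := Submodule.mem_span_singleton.mp (V.riemannRochSpace_zero_le h0)
    exact ⟨Polynomial.C c, by simp [Algebra.smul_def]⟩
  | succ n ih =>
    intro f hfP hf
    have htn : P.val (t ^ (n + 1)) = WithZero.exp ((n : ℤ) + 1) := by
      rw [map_pow, ht, ← WithZero.exp_nsmul]
      simp
    obtain ⟨c, hc⟩ := P.exists_sub_lt (f := f) (pow_ne_zero (n + 1) ht0) (by
      rw [htn]; exact_mod_cast hfP)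
    rw [htn] at hc
    obtain ⟨p, hp⟩ := ih _ (le_exp_of_lt_exp_add_one hc) (fun Q hQ => by
      refine (Q.val.map_sub _ _).trans (max_le (hf Q hQ) ?_)
      rw [map_mul, map_pow]
      exact mul_le_one' (Valuation.IsTrivialOn.valuation_algebraMap_le_one _ c)
        (pow_le_one' (ht' Q hQ) _))
    refine ⟨p + Polynomial.C c * Polynomial.X ^ (n + 1), ?_⟩
    have hp' : Polynomial.aeval t p = f - algebraMap ℂ _ c * t ^ (n + 1) := hp
    change Polynomial.aeval t _ = f
    rw [map_add, hp', map_mul, map_pow, Polynomial.aeval_C, Polynomial.aeval_X, sub_add_cancel]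

/-- If `t` has a single pole, and that pole is simple, then `ℂ(V) = ℂ(t)`. -/
lemma surjective_of_simple_pole {P : V.NormalizationPoint} {φ : RatFunc ℂ →ₐ[ℂ] V.FunctionField}
    (ht : P.val (φ RatFunc.X) = WithZero.exp 1)
    (ht' : ∀ Q, Q ≠ P → Q.val (φ RatFunc.X) ≤ 1) : Function.Surjective φ := by
  intro f
  have htr : Transcendental ℂ (φ RatFunc.X) :=
    fun h => RatFunc.transcendental_X ((isAlgebraic_algHom_iff φ φ.injective).mp h)
  set t := φ RatFunc.X with htdef
  -- a nonzero multiple `a f` with `a ∈ ℂ[t]` is integral over `ℂ[t]`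
  obtain ⟨⟨a, ha⟩, ha0, hint⟩ :=
    (isAlgebraic_adjoin_of_trdeg_le V.trdeg_functionField_le htr f).exists_integral_multiple
  rw [Algebra.adjoin_singleton_eq_range_aeval] at ha
  obtain ⟨p, rfl⟩ := ha
  have hp0 : Polynomial.aeval t p ≠ 0 := fun h => ha0 (Subtype.ext h)
  have hreg : ∀ Q, Q ≠ P → Q.val (Polynomial.aeval t p * f) ≤ 1 := by
    intro Q hQ
    have hsub : ∀ r : Algebra.adjoin ℂ {t}, (r : V.FunctionField) ∈ Q.val.integer := by
      rintro ⟨r, hr⟩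
      rw [Algebra.adjoin_singleton_eq_range_aeval] at hr
      obtain ⟨q, rfl⟩ := hr
      rw [Valuation.mem_integer_iff]
      change Q.val (Polynomial.aeval t q) ≤ 1
      rw [Polynomial.aeval_eq_sum_range]
      refine Q.val.map_sum_le fun i _ => ?_
      rw [Algebra.smul_def, map_mul, map_pow]
      exact mul_le_one' (Valuation.IsTrivialOn.valuation_algebraMap_le_one _ _)
        (pow_le_one' (ht' Q hQ) _)
    refine (Valuation.integer.integers Q.val).mem_of_integral
      (hint.map_of_comp_eq ((algebraMap (Algebra.adjoin ℂ {t}) V.FunctionField).codRestrict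
        Q.val.integer hsub) (RingHom.id _) rfl)
  obtain ⟨n, hn⟩ : ∃ n : ℕ, P.val (Polynomial.aeval t p * f) ≤ WithZero.exp (n : ℤ) := by
    refine ⟨(WithZero.log (P.val (Polynomial.aeval t p * f))).toNat, ?_⟩
    exact WithZero.le_exp_of_log_le (Int.self_le_toNat _)
  obtain ⟨q, hq⟩ := P.mem_range_aeval ht ht' n _ hn hreg
  refine ⟨algebraMap _ _ q / algebraMap _ _ p, ?_⟩
  rw [map_div₀, map_algebraMap_eq_aeval, map_algebraMap_eq_aeval, ← htdef, div_eq_iff hp0,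
    mul_comm]
  exact hq

lemma exists_surjective_of_genus_eq_zero (h : V.genus = 0) :
    ∃ φ : RatFunc ℂ →ₐ[ℂ] V.FunctionField, Function.Surjective φ := by
  rw [genus_eq_zero_iff] at h
  obtain ⟨P, -⟩ := V.exists_pole (V.transcendental_coordFun 0)
  have h2 := h (Finsupp.single P 1)
  have hdeg : V.divisorDegree (Finsupp.single P 1) = 1 := by
    simp [divisorDegree]
  rw [hdeg] at h2
  obtain ⟨t, ht, ht1⟩ : ∃ t ∈ V.riemannRochSpace (Finsupp.single P 1),
      t ∉ Submodule.span ℂ {(1 : V.FunctionField)} := by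
    by_contra! hno
    have h3 := Submodule.finrank_mono (show V.riemannRochSpace (Finsupp.single P 1) ≤ _ from hno)
    have h4 := finrank_span_singleton (K := ℂ) (one_ne_zero (α := V.FunctionField))
    omega
  have htr : Transcendental ℂ t := by
    by_contra hn
    obtain ⟨c, rfl⟩ := exists_const_of_not_transcendental hn
    rw [Algebra.algebraMap_eq_smul_one] at ht1
    exact ht1 (Submodule.smul_mem _ _ (Submodule.mem_span_singleton_self 1))
  have hreg : ∀ Q, Q ≠ P → Q.val t ≤ 1 := by
    intro Q hQ
    simpa [Finsupp.single_apply, hQ.symm] using ht Q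
  have hP : P.val t = WithZero.exp 1 := by
    refine le_antisymm (by simpa using ht P) (not_lt.mp fun hlt => ?_)
    obtain ⟨Q, hQ⟩ := V.exists_pole htr
    by_cases hQP : Q = P
    · rw [hQP] at hQ
      exact absurd (le_exp_of_lt_exp_add_one (n := 0) (by simpa using hlt))
        (not_le.mpr (by simpa using hQ))
    · exact absurd (hreg Q hQP) (not_le.mpr hQ)
  obtain ⟨φ, hφ⟩ := exists_algHom_of_transcendental htr
  exact ⟨φ, V.surjective_of_simple_pole (P := P) (by rw [hφ, hP]) (by rw [hφ]; exact hreg)⟩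

end GraphComponent

/-! ### Rational curves have genus zero -/

lemma eq_exp_of_zpowers {K : Type*} [Field K] {v : Valuation K ℤᵐ⁰}
    (hv : Function.Surjective v) {r : ℤᵐ⁰} (hr : r ≠ 0)
    (h : ∀ f : K, f ≠ 0 → ∃ n : ℤ, v f = r ^ n) :
    r = WithZero.exp 1 ∨ r = WithZero.exp (-1) := by
  obtain ⟨f, hf⟩ := hv (WithZero.exp 1)
  obtain ⟨n, hn⟩ := h f (by
    rintro rfl
    rw [map_zero] at hf
    exact WithZero.exp_ne_zero hf.symm)
  rw [hf, ← WithZero.exp_log hr, ← WithZero.exp_zsmul, WithZero.exp_inj, smul_eq_mul] at hn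
  rw [← WithZero.exp_log hr, WithZero.exp_inj, WithZero.exp_inj]
  exact Int.isUnit_iff.mp (IsUnit.of_mul_eq_one n (by rw [mul_comm]; exact hn.symm))

section RationalPlaces

open Polynomial

variable {K : Type*} [Field K] [Algebra ℂ K] {v w : Valuation K ℤᵐ⁰} [v.IsTrivialOn ℂ]
  [w.IsTrivialOn ℂ] {φ : RatFunc ℂ →ₐ[ℂ] K}

/-- The values of a valuation on `ℂ(t)` lie in any subgroup that contains those of the `t - c`. -/
lemma val_mem_zpowers_of_surjective (hφ : Function.Surjective φ) {r : ℤᵐ⁰}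
    (h : ∀ c : ℂ, ∃ n : ℤ, v (φ RatFunc.X - algebraMap ℂ K c) = r ^ n) (hr : r ≠ 0) {f : K}
    (hf : f ≠ 0) : ∃ n : ℤ, v f = r ^ n := by
  have hpoly : ∀ p : ℂ[X], p ≠ 0 → ∃ n : ℤ, v (aeval (φ RatFunc.X) p) = r ^ n := by
    intro p hp
    rw [val_aeval _ hp]
    refine Multiset.prod_induction (fun x => ∃ n : ℤ, x = r ^ n) _ ?_ ⟨0, by simp⟩ ?_
    · rintro _ _ ⟨m, rfl⟩ ⟨n, rfl⟩
      exact ⟨m + n, (zpow_add₀ hr m n).symm⟩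
    · intro x hx
      obtain ⟨c, -, rfl⟩ := Multiset.mem_map.mp hx
      exact h c
  obtain ⟨g, rfl⟩ := hφ f
  have hg : g ≠ 0 := fun h => hf (by rw [h, map_zero])
  obtain ⟨m, hm⟩ := hpoly _ (RatFunc.num_ne_zero hg)
  obtain ⟨n, hn⟩ := hpoly _ g.denom_ne_zero
  exact ⟨m - n, by rw [map_eq_aeval_div, map_div₀, hm, hn, zpow_sub₀ hr]⟩

open Classical in
/-- A discrete place of `ℂ(t)` at which `t` takes the value `a` is the order at `a`. -/
lemma val_sub_eq_of_hasValue (hφ : Function.Surjective φ) (hv : Function.Surjective v) {a : P1}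
    (ha : HasValue v (φ RatFunc.X) a) (c : ℂ) : v (φ RatFunc.X - algebraMap ℂ K c) =
      if a = OnePoint.infty then WithZero.exp 1 else if a = c then WithZero.exp (-1) else 1 := by
  induction a using OnePoint.rec with
  | infty =>
    rw [hasValue_infty] at ha
    rw [if_pos rfl, val_sub_eq_of_pole ha]
    have hr : v (φ RatFunc.X) ≠ 0 := (zero_lt_one.trans ha).ne'
    refine (eq_exp_of_zpowers hv hr fun f hf => val_mem_zpowers_of_surjective hφ
      (fun c => ⟨1, by rw [val_sub_eq_of_pole ha, zpow_one]⟩) hr hf).resolve_right fun h => ?_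
    rw [h, ← WithZero.exp_zero, WithZero.exp_lt_exp] at ha
    omega
  | coe a =>
    rw [if_neg (OnePoint.coe_ne_infty a)]
    by_cases hac : a = c
    · subst hac
      rw [if_pos rfl]
      have hr : v (φ RatFunc.X - algebraMap ℂ K a) ≠ 0 := by
        rw [Valuation.ne_zero_iff, sub_ne_zero]
        intro h
        rw [← AlgHom.commutes φ] at h
        exact RatFunc.transcendental_X (φ.injective h ▸ isAlgebraic_algebraMap a)
      refine (eq_exp_of_zpowers hv hr fun f hf => val_mem_zpowers_of_surjective hφ
        (fun c => ?_) hr hf).resolve_left fun h => ?_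
      · by_cases hac : c = a
        · exact ⟨1, by rw [hac, zpow_one]⟩
        · exact ⟨0, by rw [zpow_zero, val_sub_eq_one ha hac]⟩
      · rw [hasValue_coe, h, ← WithZero.exp_zero, WithZero.exp_lt_exp] at ha
        omega
    · rw [if_neg (fun h => hac (OnePoint.coe_injective h)), val_sub_eq_one ha (Ne.symm hac)]

lemma eq_of_hasValue (hφ : Function.Surjective φ) (hv : Function.Surjective v)
    (hw : Function.Surjective w) {a : P1} (hva : HasValue v (φ RatFunc.X) a)
    (hwa : HasValue w (φ RatFunc.X) a) : v = w := by
  have hpoly : ∀ p : ℂ[X], v (aeval (φ RatFunc.X) p) = w (aeval (φ RatFunc.X) p) := by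
    intro p
    by_cases hp : p = 0
    · simp [hp]
    · simp only [val_aeval _ hp, val_sub_eq_of_hasValue hφ hv hva,
        val_sub_eq_of_hasValue hφ hw hwa]
  refine Valuation.ext fun f => ?_
  obtain ⟨g, rfl⟩ := hφ f
  rw [map_eq_aeval_div, map_div₀, map_div₀, hpoly, hpoly]

end RationalPlaces

lemma exp_sum {ι : Type*} (s : Finset ι) (f : ι → ℤ) :
    WithZero.exp (∑ i ∈ s, f i) = ∏ i ∈ s, WithZero.exp (f i) := by
  classical
  induction s using Finset.induction_on with
  | empty => simp
  | insert i s hi ih => rw [Finset.sum_insert hi, Finset.prod_insert hi, WithZero.exp_add, ih]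

namespace GraphComponent

variable {G : RatFunc ℂ} {hG : 2 ≤ degree G} (V : GraphComponent G hG)

/-- On a rational curve, the function `∏ (t - t(P)) ^ (-D(P))` has the divisor `-D` away from the
pole of `t`, and the order there is such that the degree is zero. -/
lemma exists_multiplier {φ : RatFunc ℂ →ₐ[ℂ] V.FunctionField} (hφ : Function.Surjective φ)
    (D : V.NormalizationDivisor) : ∃ h : V.FunctionField, h ≠ 0 ∧ ∀ Q : V.NormalizationPoint,
      (Q.val (φ RatFunc.X) ≤ 1 → Q.val h = WithZero.exp (D Q)) ∧
      (1 < Q.val (φ RatFunc.X) → Q.val (φ RatFunc.X) = WithZero.exp 1 ∧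
        Q.val h = WithZero.exp (D Q - V.divisorDegree D)) := by
  classical
  choose c hc using fun P : V.NormalizationPoint => P.exists_hasValue (φ RatFunc.X)
  have hinj : ∀ P Q, c P = c Q → P = Q := fun P Q h => NormalizationPoint.ext_val
    (eq_of_hasValue hφ P.surjective Q.surjective (hc P) (h ▸ hc Q))
  let u : P1 → V.FunctionField := fun a => match a with
    | none => 1
    | some a => φ RatFunc.X - algebraMap ℂ _ a
  have hu : ∀ P Q, Q.val (u (c P)) = if c P = OnePoint.infty then 1 else
      if c Q = OnePoint.infty then WithZero.exp 1 else
      if P = Q then WithZero.exp (-1) else 1 := by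
    intro P Q
    have hPQ : P = Q ↔ c Q = c P := ⟨fun h => h ▸ rfl, fun h => (hinj _ _ h).symm⟩
    rw [hPQ]
    generalize c P = a
    induction a using OnePoint.rec with
    | infty =>
      rw [if_pos rfl]
      exact map_one _
    | coe a =>
      rw [if_neg (OnePoint.coe_ne_infty a)]
      exact val_sub_eq_of_hasValue hφ Q.surjective (hc Q) a
  have hu0 : ∀ P, u (c P) ≠ 0 := by
    intro P h0
    have := hu P P
    rw [h0, map_zero] at this
    split_ifs at this
    exacts [zero_ne_one this, WithZero.exp_ne_zero this.symm, WithZero.exp_ne_zero this.symm]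
  refine ⟨∏ P ∈ D.support, u (c P) ^ (-D P), Finset.prod_ne_zero_iff.mpr fun P _ =>
    zpow_ne_zero _ (hu0 P), fun Q => ⟨fun hQ => ?_, fun hQ => ?_⟩⟩
  · have hcQ : c Q ≠ OnePoint.infty := fun h => not_lt.mpr hQ (hasValue_infty.mp (h ▸ hc Q))
    rw [map_prod, Finset.prod_eq_single Q]
    · rw [map_zpow₀, hu, if_neg hcQ, if_neg hcQ, if_pos rfl, ← WithZero.exp_zsmul]
      simp
    · intro P _ hPQ
      rw [map_zpow₀, hu, if_neg hcQ, if_neg hPQ, ite_self, one_zpow]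
    · intro hQ0
      rw [Finsupp.notMem_support_iff.mp hQ0]
      simp
  · have hcQ : c Q = OnePoint.infty := hasValue_infty.mpr hQ |> fun h => (hc Q).unique h
    have htQ := val_sub_eq_of_hasValue hφ Q.surjective (hc Q) 0
    rw [if_pos hcQ, map_zero, sub_zero] at htQ
    refine ⟨htQ, ?_⟩
    have hterm : ∀ P, Q.val (u (c P) ^ (-D P))
        = WithZero.exp ((if P = Q then D P else 0) - D P) := by
      intro P
      rw [map_zpow₀, hu, if_pos hcQ]
      by_cases hPQ : P = Q
      · rw [hPQ, if_pos hcQ, if_pos rfl]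
        simp
      · rw [if_neg (fun h => hPQ (hinj P Q (h.trans hcQ.symm))), if_neg hPQ,
          ← WithZero.exp_zsmul]
        simp
    rw [map_prod, Finset.prod_congr rfl fun P _ => hterm P, ← exp_sum, Finset.sum_sub_distrib,
      Finset.sum_ite_eq']
    congr 2
    split_ifs with hmem
    · rfl
    · exact (Finsupp.notMem_support_iff.mp hmem).symm

lemma genus_eq_zero_of_surjective {φ : RatFunc ℂ →ₐ[ℂ] V.FunctionField}
    (hφ : Function.Surjective φ) : V.genus = 0 := by
  rw [genus_eq_zero_iff]
  intro D
  by_cases hD : V.divisorDegree D < 0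
  · omega
  obtain ⟨n, hn⟩ := Int.eq_ofNat_of_zero_le (not_lt.mp hD)
  obtain ⟨h, h0, hval⟩ := V.exists_multiplier hφ D
  have htr : Transcendental ℂ (φ RatFunc.X) :=
    fun h => RatFunc.transcendental_X ((isAlgebraic_algHom_iff φ φ.injective).mp h)
  have hle : ∀ p ∈ Polynomial.degreeLT ℂ (n + 1),
      h * Polynomial.aeval (φ RatFunc.X) p ∈ V.riemannRochSpace D := by
    intro p hp Q
    by_cases hp0 : p = 0
    · simp [hp0]
    have hpn : p.natDegree ≤ n := by
      rw [Polynomial.mem_degreeLT, Polynomial.degree_eq_natDegree hp0] at hp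
      exact_mod_cast Nat.lt_succ_iff.mp (by exact_mod_cast hp)
    rw [map_mul]
    by_cases hQ : 1 < Q.val (φ RatFunc.X)
    · obtain ⟨h1, h2⟩ := (hval Q).2 hQ
      rw [h2, val_aeval_of_pole hQ hp0, h1, ← WithZero.exp_nsmul, ← WithZero.exp_add,
        WithZero.exp_le_exp, hn]
      simp
      omega
    · rw [(hval Q).1 (not_lt.mp hQ)]
      refine mul_le_of_le_one_right' ?_
      have h1 := Q.exists_hasValue (φ RatFunc.X)
      obtain ⟨a, ha⟩ := h1
      induction a using OnePoint.rec with
      | infty => exact absurd ha hQ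
      | coe a => exact (hasValue_aeval ha p).le_one
  let L : Polynomial.degreeLT ℂ (n + 1) →ₗ[ℂ] V.riemannRochSpace D :=
    ((LinearMap.mulLeft ℂ h).comp ((Polynomial.aeval (φ RatFunc.X)).toLinearMap.comp
      (Polynomial.degreeLT ℂ (n + 1)).subtype)).codRestrict _ fun p => hle p p.2
  have hL : Function.Injective L := by
    rw [← LinearMap.ker_eq_bot, LinearMap.ker_eq_bot']
    intro p hp
    have h1 : h * Polynomial.aeval (φ RatFunc.X) (p : Polynomial ℂ) = 0 := congrArg Subtype.val hp
    exact Subtype.ext (transcendental_iff.mp htr _ ((mul_eq_zero.mp h1).resolve_left h0))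
  have h1 := LinearMap.finrank_le_finrank_of_injective hL
  have h2 : Module.finrank ℂ (Polynomial.degreeLT ℂ (n + 1)) = n + 1 := by
    rw [(Polynomial.degreeLTEquiv ℂ (n + 1)).finrank_eq, Module.finrank_fin_fun]
  rw [h2] at h1
  rw [hn]
  exact_mod_cast h1

end GraphComponent

/-! ### Rational parametrizations -/

open Polynomial in
/-- The order at a point of `ℂ`, as a place of `ℂ(X)`. -/
lemma exists_place_ratFunc (z : ℂ) : ∃ v : Valuation (RatFunc ℂ) ℤᵐ⁰, v.IsTrivialOn ℂ ∧
    HasValue v RatFunc.X (z : P1) := by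
  obtain ⟨v, -, hv, h⟩ := exists_valuation_lt_one_of_isDedekindDomain (K := RatFunc ℂ)
    (X_sub_C_ne_zero z) (not_isUnit_X_sub_C z)
  refine ⟨v, hv, ?_⟩
  rw [hasValue_coe]
  rwa [map_sub, RatFunc.algebraMap_X, RatFunc.algebraMap_C] at h

lemma HasValue.toMap {v : Valuation (RatFunc ℂ) ℤᵐ⁰} [v.IsTrivialOn ℂ] {z : P1}
    (h : HasValue v RatFunc.X z) (g : RatFunc ℂ) : HasValue v g (toMap g z) :=
  HasValue.map (φ := AlgHom.id ℂ (RatFunc ℂ)) h g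

lemma finite_poles (g : RatFunc ℂ) : {z : ℂ | toMap g (z : P1) = OnePoint.infty}.Finite := by
  refine (g.denom.roots.toFinset.finite_toSet).subset fun z hz => ?_
  simp only [Multiset.mem_toFinset, Finset.mem_coe, Polynomial.mem_roots g.denom_ne_zero]
  by_contra h
  have : RatCorr.toMap g (z : P1) = ((g.num.eval z / g.denom.eval z : ℂ) : P1) := if_neg h
  exact OnePoint.coe_ne_infty _ (this.symm.trans hz)

lemma finite_zeros {g : RatFunc ℂ} (hg : g ≠ 0) :
    {z : ℂ | toMap g (z : P1) = ((0 : ℂ) : P1)}.Finite := by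
  refine (g.num.roots.toFinset.finite_toSet).subset fun z hz => ?_
  simp only [Multiset.mem_toFinset, Finset.mem_coe, Polynomial.mem_roots (RatFunc.num_ne_zero hg)]
  by_cases h : g.denom.eval z = 0
  · have : RatCorr.toMap g (z : P1) = OnePoint.infty := if_pos h
    exact absurd (this.symm.trans hz) (OnePoint.infty_ne_coe _)
  · have : RatCorr.toMap g (z : P1) = ((g.num.eval z / g.denom.eval z : ℂ) : P1) := if_neg h
    have := OnePoint.coe_injective (this.symm.trans hz)
    exact (div_eq_zero_iff.mp this).resolve_right h

lemma toMap_aeval {g f : RatFunc ℂ} {z α β : ℂ} (hg : toMap g (z : P1) = (α : P1))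
    (hf : toMap f (z : P1) = (β : P1)) (p : MvPolynomial (Fin 2) ℂ) :
    toMap (MvPolynomial.aeval ![g, f] p) (z : P1) = ((MvPolynomial.eval ![α, β] p : ℂ) : P1) := by
  obtain ⟨v, hv, hz⟩ := exists_place_ratFunc z
  refine (hz.toMap _).unique (hasValue_mvPolynomial_aeval (fun i => ?_) p)
  fin_cases i
  · exact hg ▸ hz.toMap g
  · exact hf ▸ hz.toMap f

namespace GraphComponent

variable {G : RatFunc ℂ} {hG : 2 ≤ degree G} (V : GraphComponent G hG)

lemma exists_place_of_algHom (φ : RatFunc ℂ →ₐ[ℂ] V.FunctionField) (z : P1) :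
    ∃ v : Valuation V.FunctionField ℤᵐ⁰, v.IsTrivialOn ℂ ∧ HasValue v (φ RatFunc.X) z := by
  have htr : Transcendental ℂ (φ RatFunc.X) :=
    fun h => RatFunc.transcendental_X ((isAlgebraic_algHom_iff φ φ.injective).mp h)
  induction z using OnePoint.rec with
  | infty =>
    obtain ⟨v, -, hv, h⟩ := exists_discrete_place_pole V.trdeg_functionField_le htr
    exact ⟨v, hv, h⟩
  | coe z =>
    obtain ⟨v, -, hv, h⟩ := exists_discrete_place_zero V.trdeg_functionField_le
      (s := φ RatFunc.X - algebraMap ℂ _ z) fun h => htr (by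
        simpa using h.add (isAlgebraic_algebraMap z))
    exact ⟨v, hv, h⟩

lemma range_eq_carrier {φ : RatFunc ℂ →ₐ[ℂ] V.FunctionField} {g f : RatFunc ℂ}
    (hg : φ g = V.coordFun 0) (hf : φ f = V.coordFun 1) :
    Set.range (fun z : P1 => (toMap g z, toMap f z)) = V.carrier := by
  ext p
  constructor
  · rintro ⟨z, rfl⟩
    obtain ⟨v, hv, hz⟩ := V.exists_place_of_algHom φ z
    exact V.mem_carrier_of_hasValue (v := v) (hg ▸ hz.map g) (hf ▸ hz.map f)
  · intro hp
    obtain ⟨B, hB, h1, h2⟩ := V.exists_place_of_mem hp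
    have hnt : ∃ s, s ≠ 0 ∧ B.valuation s < 1 := by
      rw [← V.localParam_lt_one_iff (V.coordFun_ne_zero 0)] at h1
      refine ⟨_, ?_, h1⟩
      have htr := V.transcendental_coordFun 0
      rcases p.1 with _ | a
      · exact inv_ne_zero (V.coordFun_ne_zero 0)
      · refine sub_ne_zero.mpr fun h => htr ?_
        rw [h]
        exact isAlgebraic_algebraMap a
    obtain ⟨z, hz⟩ := V.exists_hasValue_functionField hnt (φ RatFunc.X)
    exact ⟨z, Prod.ext ((hg ▸ hz.map g).unique h1) ((hf ▸ hz.map f).unique h2)⟩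

/-- A generator of the function field is a rational expression in `x` and `y`, which recovers the
parameter of all but finitely many points. -/
lemma isRationalParametrization_of_algHom {φ : RatFunc ℂ →ₐ[ℂ] V.FunctionField}
    {g f : RatFunc ℂ} (hg : φ g = V.coordFun 0)
    (hf : φ f = V.coordFun 1) : V.IsRationalParametrization g f := by
  refine ⟨V.range_eq_carrier hg hf, ?_⟩
  obtain ⟨P, Q, hQ, hPQ⟩ := IsFractionRing.div_surjective
    (A := MvPolynomial (Fin 2) ℂ ⧸ V.ideal) (φ RatFunc.X)
  obtain ⟨p, rfl⟩ := Ideal.Quotient.mk_surjective P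
  obtain ⟨q, rfl⟩ := Ideal.Quotient.mk_surjective Q
  have hmap : ∀ p : MvPolynomial (Fin 2) ℂ,
      φ (MvPolynomial.aeval ![g, f] p) = MvPolynomial.aeval V.coordFun p := by
    intro p
    rw [← AlgHom.comp_apply, MvPolynomial.comp_aeval]
    congr 2
    funext i
    fin_cases i
    exacts [hg, hf]
  rw [← aeval_coordFun, ← aeval_coordFun, ← hmap, ← hmap, ← map_div₀] at hPQ
  have hX := φ.injective hPQ
  have hq0 : MvPolynomial.aeval ![g, f] q ≠ 0 := by
    intro h
    rw [h, div_zero] at hX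
    exact RatFunc.X_ne_zero hX.symm
  rw [div_eq_iff hq0] at hX
  let E : Set ℂ := {z | toMap g (z : P1) = OnePoint.infty} ∪
    {z | toMap f (z : P1) = OnePoint.infty} ∪
    {z | toMap (MvPolynomial.aeval ![g, f] q) (z : P1) = ((0 : ℂ) : P1)}
  have hE : E.Finite := ((finite_poles g).union (finite_poles f)).union (finite_zeros hq0)
  refine ⟨insert OnePoint.infty ((fun z : ℂ => (z : P1)) '' E), (hE.image _).insert _, ?_⟩
  have key : ∀ z : P1, z ∉ insert OnePoint.infty ((fun z : ℂ => (z : P1)) '' E) →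
    ∃ (c α β : ℂ), z = (c : P1) ∧ toMap g z = (α : P1) ∧ toMap f z = (β : P1) ∧
      c = MvPolynomial.eval ![α, β] p / MvPolynomial.eval ![α, β] q := by
    intro z hz
    rw [Set.mem_insert_iff, not_or] at hz
    obtain ⟨hz, hz'⟩ := hz
    obtain ⟨c, rfl⟩ := OnePoint.ne_infty_iff_exists.mp hz
    have hz'' : c ∉ E := fun h => hz' ⟨c, h, rfl⟩
    simp only [E, Set.mem_union, Set.mem_ofPred_eq, not_or] at hz''
    obtain ⟨⟨h1, h2⟩, h3⟩ := hz''
    obtain ⟨α, hα⟩ := OnePoint.ne_infty_iff_exists.mp h1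
    obtain ⟨β, hβ⟩ := OnePoint.ne_infty_iff_exists.mp h2
    refine ⟨c, α, β, rfl, hα.symm, hβ.symm, ?_⟩
    have hq := toMap_aeval hα.symm hβ.symm q
    rw [hq] at h3
    have hq0 : MvPolynomial.eval ![α, β] q ≠ 0 := fun h => h3 (by rw [h])
    rw [eq_div_iff hq0]
    obtain ⟨v, hv, hc⟩ := exists_place_ratFunc c
    have h4 := toMap_aeval hα.symm hβ.symm p
    have h5 : HasValue v (RatFunc.X * MvPolynomial.aeval ![g, f] q)
        ((c * MvPolynomial.eval ![α, β] q : ℂ) : P1) := by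
      have := hasValue_mvPolynomial_aeval (v := v) (f := ![RatFunc.X, MvPolynomial.aeval ![g, f] q])
        (a := ![c, MvPolynomial.eval ![α, β] q]) (fun i => by
          fin_cases i
          · exact hc
          · exact hq ▸ hc.toMap _) (MvPolynomial.X 0 * MvPolynomial.X 1)
      simpa using this
    rw [← hX] at h5
    exact OnePoint.coe_injective (h5.unique (h4 ▸ hc.toMap _))
  intro z hz z' hz' h
  obtain ⟨c, α, β, rfl, h1, h2, h3⟩ := key z hz
  obtain ⟨c', α', β', rfl, h1', h2', h3'⟩ := key z' hz'
  obtain ⟨hg', hf'⟩ := Prod.mk.inj h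
  have hα : α = α' := OnePoint.coe_injective (h1.symm.trans (hg'.trans h1'))
  have hβ : β = β' := OnePoint.coe_injective (h2.symm.trans (hf'.trans h2'))
  rw [h3, h3', hα, hβ]

end GraphComponent

namespace GraphComponent

variable {G : RatFunc ℂ} {hG : 2 ≤ degree G} (V : GraphComponent G hG)

/-! ### Rational maps to the component -/

/-- A pair of rational functions that satisfies the equations of `V` defines an embedding of the
function field, unless the first one is constant: an element of the kernel would divide a nonzero
polynomial in `x`. -/
lemma mem_ideal_of_aeval_eq_zero {g f : RatFunc ℂ} (hg : Transcendental ℂ g)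
    (h : ∀ p ∈ V.ideal, MvPolynomial.aeval ![g, f] p = 0) {p : MvPolynomial (Fin 2) ℂ}
    (hp : MvPolynomial.aeval ![g, f] p = 0) : p ∈ V.ideal := by
  rw [← aeval_coordFun_eq_zero_iff]
  by_contra hr
  set r := MvPolynomial.aeval V.coordFun p with hrdef
  obtain ⟨q, hq0, hq⟩ := (isAlgebraic_adjoin_of_trdeg_le V.trdeg_functionField_le
    (V.transcendental_coordFun 0) r).exists_nonzero_coeff_and_aeval_eq_zero
      (mem_nonZeroDivisors_of_ne_zero hr)
  have hadj : Algebra.adjoin ℂ {V.coordFun 0} ≤ (MvPolynomial.aeval (R := ℂ) V.coordFun).range := by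
    rw [Algebra.adjoin_le_iff, Set.singleton_subset_iff]
    exact ⟨MvPolynomial.X 0, MvPolynomial.aeval_X _ _⟩
  obtain ⟨s, hs⟩ : Polynomial.aeval r q.divX ∈ (MvPolynomial.aeval (R := ℂ) V.coordFun).range := by
    rw [Polynomial.aeval_eq_sum_range]
    refine sum_mem fun i _ => ?_
    rw [Algebra.smul_def]
    exact mul_mem (hadj (q.divX.coeff i).2) (pow_mem (AlgHom.mem_range_self _ p) i)
  obtain ⟨a, ha⟩ : (q.coeff 0 : V.FunctionField) ∈
      (Polynomial.aeval (R := ℂ) (V.coordFun 0)).range := by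
    rw [← Algebra.adjoin_singleton_eq_range_aeval]
    exact (q.coeff 0).2
  have ha' : Polynomial.aeval (V.coordFun 0) a = (q.coeff 0 : V.FunctionField) := ha
  have hs' : MvPolynomial.aeval V.coordFun s = Polynomial.aeval r q.divX := hs
  have h0 : Polynomial.aeval r q =
      r * Polynomial.aeval r q.divX + (q.coeff 0 : V.FunctionField) := by
    conv_lhs => rw [← Polynomial.X_mul_divX_add q]
    rw [map_add, map_mul, Polynomial.aeval_X, Polynomial.aeval_C]
    rfl
  rw [hq, ← hs', ← ha', ← aeval_coordFun_X_poly, hrdef, ← map_mul, ← map_add, eq_comm,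
    aeval_coordFun_eq_zero_iff] at h0
  have h1 := h _ h0
  rw [map_add, map_mul, hp, zero_mul, zero_add, ← Polynomial.aeval_algHom_apply,
    MvPolynomial.aeval_X] at h1
  have ha0 : a = 0 := transcendental_iff.mp hg _ h1
  rw [ha0, map_zero] at ha'
  exact hq0 (Subtype.ext ha'.symm)

/-- Lüroth's theorem: a curve that admits a nonconstant rational map from the line is rational. -/
lemma exists_surjective_of_forall_mem_ideal {g f : RatFunc ℂ} (hg : Transcendental ℂ g)
    (h : ∀ p ∈ V.ideal, MvPolynomial.aeval ![g, f] p = 0) :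
    ∃ φ : RatFunc ℂ →ₐ[ℂ] V.FunctionField, Function.Surjective φ := by
  let ψ₀ : MvPolynomial (Fin 2) ℂ ⧸ V.ideal →ₐ[ℂ] RatFunc ℂ :=
    Ideal.Quotient.liftₐ V.ideal (MvPolynomial.aeval ![g, f]) h
  have hψ₀ : Function.Injective ψ₀ := by
    rw [injective_iff_map_eq_zero]
    intro a ha
    obtain ⟨p, rfl⟩ := Ideal.Quotient.mk_surjective a
    exact Ideal.Quotient.eq_zero_iff_mem.mpr (V.mem_ideal_of_aeval_eq_zero hg h ha)
  let ψ : V.FunctionField →ₐ[ℂ] RatFunc ℂ := IsFractionRing.liftAlgHom hψ₀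
  have hψx : ψ (V.coordFun 0) = g := by
    have h1 : ψ (V.coordFun 0) = ψ₀ (Ideal.Quotient.mk V.ideal (MvPolynomial.X 0)) := by
      simp [ψ, coordFun]
    rw [h1]
    exact MvPolynomial.aeval_X ![g, f] 0
  have hE : ψ.fieldRange ≠ ⊥ := by
    intro hbot
    have hmem : g ∈ ψ.fieldRange := ⟨_, hψx⟩
    rw [hbot, IntermediateField.mem_bot] at hmem
    obtain ⟨c, rfl⟩ := hmem
    exact hg (isAlgebraic_algebraMap c)
  let e : V.FunctionField ≃ₐ[ℂ] ψ.fieldRange := AlgEquiv.ofInjectiveField ψ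
  exact ⟨((RatFunc.Luroth.algEquiv hE).trans e.symm).toAlgHom,
    ((RatFunc.Luroth.algEquiv hE).trans e.symm).surjective⟩

end GraphComponent

lemma toMap_coe_of_ne {g : RatFunc ℂ} {z : ℂ} (h : g.denom.eval z ≠ 0) :
    toMap g (z : P1) = ((g.num.eval z / g.denom.eval z : ℂ) : P1) := if_neg h

lemma denom_ne_zero_of_toMap_eq {g : RatFunc ℂ} {z w : ℂ} (h : toMap g (z : P1) = (w : P1)) :
    g.denom.eval z ≠ 0 ∧ w = g.num.eval z / g.denom.eval z := by
  have h1 : g.denom.eval z ≠ 0 := by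
    intro h0
    have h2 : toMap g (z : P1) = OnePoint.infty := if_pos h0
    exact OnePoint.infty_ne_coe w (h2.symm.trans h)
  exact ⟨h1, OnePoint.coe_injective (h.symm.trans (toMap_coe_of_ne h1))⟩

lemma continuousAt_fraction {g : RatFunc ℂ} {z : ℂ} (h : g.denom.eval z ≠ 0) :
    ContinuousAt (fun z => g.num.eval z / g.denom.eval z) z :=
  g.num.continuousAt.div g.denom.continuousAt h

lemma transcendental_of_degree {g : RatFunc ℂ} (hg : 1 ≤ degree g) : Transcendental ℂ g := by
  refine RatFunc.transcendental_of_ne_C g ?_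
  rintro ⟨c, rfl⟩
  simp [degree] at hg

namespace GraphComponent

variable {G : RatFunc ℂ} {hG : 2 ≤ degree G} (V : GraphComponent G hG)

lemma aeval_eq_zero_of_branchCompEq {g f : RatFunc ℂ} (h : V.BranchCompEq g f) :
    ∀ p ∈ V.ideal, MvPolynomial.aeval ![g, f] p = 0 := by
  obtain ⟨z₀, w₀, b, hz₀, ⟨-, hb⟩, hev⟩ := h
  intro p hp
  by_contra hne
  obtain ⟨hd, rfl⟩ := denom_ne_zero_of_toMap_eq hz₀
  have h1 : ∀ᶠ z : ℂ in 𝓝 z₀, z ∈ {z : ℂ | toMap (MvPolynomial.aeval ![g, f] p) (z : P1)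
      = ((0 : ℂ) : P1)} := by
    filter_upwards [hev, (continuousAt_fraction hd).eventually hb] with z ⟨w, hw, hw'⟩ hz
    obtain ⟨-, rfl⟩ := denom_ne_zero_of_toMap_eq hw
    refine (toMap_aeval hw hw' p).trans ?_
    rw [(V.mem_ideal_iff p).mp hp _ hz]
  exact (infinite_of_mem_nhds z₀ h1) (finite_zeros hne)

/-! ### Branches from parametrizations -/

open Polynomial in
/-- A nonconstant rational function is not stationary. -/
lemma wronskian_ne_zero {g : RatFunc ℂ} (hg : 1 ≤ degree g) :
    derivative g.num * g.denom - g.num * derivative g.denom ≠ 0 := by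
  intro h
  have h1 : derivative g.num * g.denom = g.num * derivative g.denom := sub_eq_zero.mp h
  have hdvd : g.denom ∣ derivative g.denom :=
    g.isCoprime_num_denom.symm.dvd_of_dvd_mul_left ⟨derivative g.num, by rw [← h1, mul_comm]⟩
  have hd : derivative g.denom = 0 := by
    by_contra h0
    have h2 := natDegree_le_of_dvd hdvd h0
    have h3 : g.denom.natDegree ≠ 0 := fun h3 => h0 (derivative_of_natDegree_zero h3)
    exact absurd h2 (not_le.mpr (natDegree_derivative_lt h3))
  rw [hd, mul_zero] at h1
  have hn : derivative g.num = 0 := (mul_eq_zero.mp h1).resolve_right g.denom_ne_zero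
  have h2 := derivative_eq_zero.mp hd
  have h3 := derivative_eq_zero.mp hn
  simp [degree, h2, h3] at hg

/-- Away from the poles of `g` and `f` and the critical points of `g`, the function
`f ∘ g⁻¹` is a branch. -/
lemma branchCompEq_of_forall_mem {g f : RatFunc ℂ} (hg : 1 ≤ degree g)
    (h : ∀ z : P1, (toMap g z, toMap f z) ∈ V.carrier) : V.BranchCompEq g f := by
  obtain ⟨z₀, hz₀⟩ : ∃ z₀ : ℂ, (g.denom * f.denom * (Polynomial.derivative g.num * g.denom
      - g.num * Polynomial.derivative g.denom)).eval z₀ ≠ 0 := by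
    by_contra! hall
    exact mul_ne_zero (mul_ne_zero g.denom_ne_zero f.denom_ne_zero) (wronskian_ne_zero hg)
      (Polynomial.funext fun z => by rw [hall z, Polynomial.eval_zero])
  rw [Polynomial.eval_mul, Polynomial.eval_mul] at hz₀
  have hgd := left_ne_zero_of_mul (left_ne_zero_of_mul hz₀)
  have hfd := right_ne_zero_of_mul (left_ne_zero_of_mul hz₀)
  have hW := right_ne_zero_of_mul hz₀
  have han : ∀ r : RatFunc ℂ, r.denom.eval z₀ ≠ 0 →
      AnalyticAt ℂ (fun z => r.num.eval z / r.denom.eval z) z₀ := fun r hr =>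
    (AnalyticOnNhd.eval_polynomial r.num z₀ trivial).div
      (AnalyticOnNhd.eval_polynomial r.denom z₀ trivial) hr
  set gf : ℂ → ℂ := fun z => g.num.eval z / g.denom.eval z with hgf
  set ff : ℂ → ℂ := fun z => f.num.eval z / f.denom.eval z with hff
  have hderiv : deriv gf z₀ ≠ 0 := by
    have h1 := (g.num.hasDerivAt z₀).div (g.denom.hasDerivAt z₀) hgd
    have h2 : deriv gf z₀ = _ := h1.deriv
    rw [h2]
    refine div_ne_zero ?_ (pow_ne_zero _ hgd)
    simpa using hW
  have hga : AnalyticAt ℂ gf z₀ := han g hgd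
  have hfa : AnalyticAt ℂ ff z₀ := han f hfd
  have hs : HasStrictDerivAt gf (deriv gf z₀) z₀ := hga.hasStrictDerivAt
  let r := hs.localInverse gf (deriv gf z₀) z₀ hderiv
  have hra : AnalyticAt ℂ r (gf z₀) := hga.analyticAt_localInverse hderiv
  have hr0 : r (gf z₀) = z₀ := HasStrictFDerivAt.localInverse_apply_image _
  have hden : ∀ᶠ z in 𝓝 z₀, g.denom.eval z ≠ 0 ∧ f.denom.eval z ≠ 0 :=
    (g.denom.continuousAt.eventually_ne hgd).and (f.denom.continuousAt.eventually_ne hfd)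
  refine ⟨z₀, gf z₀, ff ∘ r, toMap_coe_of_ne hgd, ⟨?_, ?_⟩, ?_⟩
  · exact AnalyticAt.comp (by rw [hr0]; exact hfa) hra
  · have htend : Filter.Tendsto r (𝓝 (gf z₀)) (𝓝 z₀) := by
      simpa [ContinuousAt, hr0] using hra.continuousAt
    filter_upwards [HasStrictDerivAt.eventually_right_inverse hs hderiv, htend.eventually hden]
      with w hw hd
    have h1 := h (r w)
    rw [toMap_coe_of_ne hd.1, toMap_coe_of_ne hd.2] at h1
    have h2 : g.num.eval (r w) / g.denom.eval (r w) = w := hw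
    rwa [h2] at h1
  · filter_upwards [hden, HasStrictDerivAt.eventually_left_inverse hs hderiv] with z hd hz
    refine ⟨gf z, toMap_coe_of_ne hd.1, ?_⟩
    have h2 : r (gf z) = z := hz
    rw [Function.comp_apply, h2]
    exact toMap_coe_of_ne hd.2

end GraphComponent

lemma toMap_eq_of_degree_eq_zero {g : RatFunc ℂ} (hg : degree g = 0) (z : P1) :
    toMap g z = toMap g OnePoint.infty := by
  have hn : g.num.natDegree = 0 := Nat.le_zero.mp (hg ▸ le_max_left _ _)
  have hd : g.denom.natDegree = 0 := Nat.le_zero.mp (hg ▸ le_max_right _ _)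
  have hd0 : g.denom.coeff 0 ≠ 0 := by
    rw [← hd]
    exact Polynomial.leadingCoeff_ne_zero.mpr g.denom_ne_zero
  have hev : ∀ (p : Polynomial ℂ) (c : ℂ), p.natDegree = 0 → p.eval c = p.coeff 0 := by
    intro p c hp
    conv_lhs => rw [Polynomial.eq_C_of_natDegree_eq_zero hp, Polynomial.eval_C]
  have hinf : toMap g OnePoint.infty = ((g.num.coeff g.denom.natDegree /
      g.denom.coeff g.denom.natDegree : ℂ) : P1) := if_neg (by omega)
  induction z using OnePoint.rec with
  | infty => rfl
  | coe c =>
    rw [hinf, toMap_coe_of_ne (by rwa [hev _ c hd]), hev _ c hn, hev _ c hd, hd]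

namespace GraphComponent

variable {G : RatFunc ℂ} {hG : 2 ≤ degree G} (V : GraphComponent G hG)

variable {V} in
/-- Both coordinates of a parametrization are nonconstant, since `V` is infinite and `G` has finite
fibres. -/
lemma IsRationalParametrization.one_le_degree {g f : RatFunc ℂ}
    (h : V.IsRationalParametrization g f) : 1 ≤ degree g ∧ 1 ≤ degree f := by
  obtain ⟨hrange, E, hE, hinj⟩ := h
  have hinf : V.carrier.Infinite := by
    rw [← hrange]
    exact ((hE.infinite_compl).image hinj).mono (Set.image_subset_range _ _)
  have hmem : ∀ z, toMap G (toMap g z) = toMap G (toMap f z) := fun z =>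
    V.maximal.prop.1 (hrange ▸ Set.mem_range_self z)
  have key : ∀ A B : Set P1, A.Finite → B.Finite → (∀ z, toMap g z ∈ A) → (∀ z, toMap f z ∈ B) →
      False := by
    intro A B hA hB h1 h2
    refine hinf ((hA.prod hB).subset ?_)
    rw [← hrange]
    rintro _ ⟨z, rfl⟩
    exact ⟨h1 z, h2 z⟩
  constructor
  · by_contra h0
    have hc := toMap_eq_of_degree_eq_zero (g := g) (by omega)
    refine key {toMap g OnePoint.infty} _ (Set.finite_singleton _)
      (finite_fiber hG (toMap G (toMap g OnePoint.infty))) hc fun z => ?_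
    rw [← hc z]
    exact (hmem z).symm
  · by_contra h0
    have hc := toMap_eq_of_degree_eq_zero (g := f) (by omega)
    refine key _ {toMap f OnePoint.infty} (finite_fiber hG (toMap G (toMap f OnePoint.infty)))
      (Set.finite_singleton _) (fun z => ?_) hc
    rw [← hc z]
    exact hmem z

end GraphComponent
end RatCorr

end

theorem theorem2p2 (G : RatFunc ℂ) (hG : 2 ≤ RatCorr.degree G)
    (V : RatCorr.GraphComponent G hG) :
    List.TFAE [
      V.genus = 0,
      ∃ g f : RatFunc ℂ, 1 ≤ RatCorr.degree g ∧ 1 ≤ RatCorr.degree f ∧ V.BranchCompEq g f,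
      ∃ g f : RatFunc ℂ, V.IsRationalParametrization g f] := by
  tfae_have 1 → 3 := by
    intro h
    obtain ⟨φ, hφ⟩ := V.exists_surjective_of_genus_eq_zero h
    obtain ⟨g, hg⟩ := hφ (V.coordFun 0)
    obtain ⟨f, hf⟩ := hφ (V.coordFun 1)
    exact ⟨g, f, V.isRationalParametrization_of_algHom hg hf⟩
  tfae_have 3 → 2 := by
    rintro ⟨g, f, h⟩
    obtain ⟨hg, hf⟩ := h.one_le_degree
    exact ⟨g, f, hg, hf, V.branchCompEq_of_forall_mem hg
      fun z => h.1 ▸ Set.mem_range_self (f := fun z => (RatCorr.toMap g z, RatCorr.toMap f z)) z⟩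
  tfae_have 2 → 1 := by
    rintro ⟨g, f, hg, -, h⟩
    obtain ⟨φ, hφ⟩ := V.exists_surjective_of_forall_mem_ideal
      (RatCorr.transcendental_of_degree hg) (V.aeval_eq_zero_of_branchCompEq h)
    exact V.genus_eq_zero_of_surjective hφ
  tfae_finish
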